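/- Let $(G,\Lambda_G)$ be a finite-dimensional real Lie–Poisson (Poisson–Lie) group with Lie algebra $\mathcal G$, let $(G^*,\Lambda_{G^*})$ be its (connected) dual Lie–Poisson group, with Lie algebra $\mathcal G^*$ whose bracket is the linearization of $\Lambda_G$ at the unit, while the linearization of $\Lambda_{G^*}$ is the bracket of $\mathcal G$. Let $D=D(G,\Lambda_G)$ be a complete group double: a Lie group containing $G$ and $G^*$ as Lie subgroups, with Lie algebra $\mathcal G\oplus\mathcal G^*$ on which the canonical symmetric pairing is $\mathrm{Ad}_D$-invariant, and such that $G\times G^*\to D$, $(g,u)\mapsto gu$, is a diffeomorphism. Let $X_i$, $Y_i$ be dual bases of $\mathcal G$, $\mathcal G^*$, let $X_i^l$ be the left-invariant vector fields on $G$ and $Y_i^r$ the right-invariant vector fields on $G^*$ with values $X_i$, $Y_i$ at the unit, and put $r=\sum_i X_i\wedge Y_i=\sum_i(X_i\otimes Y_i-Y_i\otimes X_i)$. Let $\Lambda_D^+=-\tfrac12(r^l+r^r)$ be the natural Poisson tensor of $D$, where $r^l$, $r^r$ are the left- and right-invariant bivector fields on $D$ with value $r$ at the unit, and let $\mu:D\to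 G^*$, $\mu(gu)=u$. For a bivector field $\Lambda$ and a 1-form $\alpha$ write $\Lambda(\alpha)=\Lambda(\alpha,\cdot)$. Let $\eta$ be an arbitrary smooth 1-form on $G^*$, let $\Gamma_\eta=\Lambda_D^+(\mu^*\eta)$, and put $L_\eta(u)=\sum_i\langle Y_i^r,\eta\rangle(u)\,X_i\in\mathcal G$. (1) In the coordinates $(g,u)\in G\times G^*\cong D$, $$\Gamma_\eta(g,u)=\sum_i\langle Y_i^r,\eta\rangle(u)\,X_i^l(g)+\Lambda_{G^*}(\eta)(u).$$ (2) Consequently, on an open set of times, a curve $g(t)u(t)$ in $D$ is an integral curve of $\Gamma_\eta$ if and only if $$\dot u=\Lambda_{G^*}(\eta)(u),\qquad g^{-1}\dot g=\sum_i\langle Y_i^r,\eta\rangle(u)\,X_i .$$ (3) The system is integrable by quadratures whenever the momentum equation $\dot u=\Lambda_{G^*}(\eta)(u)$ can be integrated and the velocities stay in a commutative subalgebra, in the following sense. Let $u$ be a solution of the momentum equation on an open interval $J$, let $t_0\in J$, and suppose that $L_\eta(u(t))$ lies in a commutative subalgebra of $\mathcal G$ for all $t\in J$. Then the functions $t\mapsto\langle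 Y_i^r,\eta\rangle(u(t))$ are continuous on $J$, and for every curve $g$ in $G$, the curve $g(t)u(t)$ is an integral curve of $\Gamma_\eta$ on $J$ if and only if, for all $t\in J$, $$g(t)=g(t_0)\exp\Big(\sum_i\Big(\int_{t_0}^t\langle Y_i^r,\eta\rangle(u(s))\,ds\Big)X_i\Big).$$ -/

import Mathlib

open Set
open scoped Manifold ContDiff

noncomputable section

namespace PoissonLie

/-! ### Left and right translations, adjoint action, exponential map -/

section LieGroup

variable {E : Type*} [NormedAddCommGroup E] [NormedSpace ℝ E]
  {G : Type*} [TopologicalSpace G] [ChartedSpace E G] [Group G]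

/-- The differential `T_h G → T_{gh} G` of the left translation `x ↦ g x`. -/
def dL (g h : G) : TangentSpace 𝓘(ℝ, E) h →ₗ[ℝ] TangentSpace 𝓘(ℝ, E) (g * h) :=
  (mfderiv 𝓘(ℝ, E) 𝓘(ℝ, E) (fun x : G => g * x) h).toLinearMap

/-- The differential `T_g G → T_{gh} G` of the right translation `x ↦ x h`. -/
def dR (h g : G) : TangentSpace 𝓘(ℝ, E) g →ₗ[ℝ] TangentSpace 𝓘(ℝ, E) (g * h) :=
  (mfderiv 𝓘(ℝ, E) 𝓘(ℝ, E) (fun x : G => x * h) g).toLinearMap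

/-- The left translate `T_1 G → T_g G`. -/
def leftTranslate (g : G) : GroupLieAlgebra 𝓘(ℝ, E) G →ₗ[ℝ] TangentSpace 𝓘(ℝ, E) g :=
  (mfderiv 𝓘(ℝ, E) 𝓘(ℝ, E) (fun x : G => g * x) 1).toLinearMap

/-- The right translate `T_1 G → T_g G`. -/
def rightTranslate (g : G) : GroupLieAlgebra 𝓘(ℝ, E) G →ₗ[ℝ] TangentSpace 𝓘(ℝ, E) g :=
  (mfderiv 𝓘(ℝ, E) 𝓘(ℝ, E) (fun x : G => x * g) 1).toLinearMap

/-- The right translate back to the unit, `T_g G → T_1 G`. -/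
def rightTranslateInv (g : G) : TangentSpace 𝓘(ℝ, E) g →ₗ[ℝ] GroupLieAlgebra 𝓘(ℝ, E) G :=
  (mfderiv 𝓘(ℝ, E) 𝓘(ℝ, E) (fun x : G => x * g⁻¹) g).toLinearMap

/-- The adjoint action of `g` on the Lie algebra. -/
def Ad (g : G) : GroupLieAlgebra 𝓘(ℝ, E) G →ₗ[ℝ] GroupLieAlgebra 𝓘(ℝ, E) G :=
  (mfderiv 𝓘(ℝ, E) 𝓘(ℝ, E) (fun x : G => g * x * g⁻¹) 1).toLinearMap

open Classical in
/-- The exponential map of a Lie group: the value at time `1` of the one-parameter subgroup with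
initial velocity `X`, that is, of the integral curve through the unit of the left-invariant vector
field given by `X`. (On a Lie group this curve exists and is unique, so the default value is never
used.) -/
def lieExp (X : GroupLieAlgebra 𝓘(ℝ, E) G) : G :=
  if h : ∃ γ : ℝ → G, IsMIntegralCurve (I := 𝓘(ℝ, E)) γ (fun g => leftTranslate g X) ∧ γ 0 = 1
  then h.choose 1 else 1

end LieGroup

/-! ### Bivector fields and Lie-Poisson structures -/

section Bivector

variable (E : Type*) [NormedAddCommGroup E] [NormedSpace ℝ E]
  (M : Type*) [TopologicalSpace M] [ChartedSpace E M]

/-- A bivector field `Λ` on a manifold, given at each point `x` by the skew-symmetric map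
`Λ♯ : T*_x M → T_x M`, `Λ♯ α = Λ(α, ·)`. Thus `Λ(α, β) = β (Λ♯ α)`, and for vectors `V`, `W` the
bivector `V ∧ W = V ⊗ W - W ⊗ V` corresponds to `α ↦ α(V) W - α(W) V`. -/
structure BivectorField where
  /-- contraction with a covector in the first slot -/
  sharp : ∀ x : M, Module.Dual ℝ (TangentSpace 𝓘(ℝ, E) x) →ₗ[ℝ] TangentSpace 𝓘(ℝ, E) x
  skew : ∀ (x : M) (α : Module.Dual ℝ (TangentSpace 𝓘(ℝ, E) x)), α (sharp x α) = 0

variable {E M}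

/-- The differential of a real function at a point, as a covector. -/
def differential (f : M → ℝ) (x : M) : Module.Dual ℝ (TangentSpace 𝓘(ℝ, E) x) :=
  (NormedSpace.fromTangentSpace (𝕜 := ℝ) (f x)).toLinearMap ∘ₗ
    (mfderiv 𝓘(ℝ, E) 𝓘(ℝ, ℝ) f x).toLinearMap

/-- The bracket `{f, h} = Λ(df, dh)` of functions. -/
def BivectorField.bracket (Λ : BivectorField E M) (f h : M → ℝ) (x : M) : ℝ :=
  differential h x (Λ.sharp x (differential f x))

end Bivector

section LiePoisson

variable {E : Type*} [NormedAddCommGroup E] [NormedSpace ℝ E]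
  {G : Type*} [TopologicalSpace G] [ChartedSpace E G] [Group G]

/-- The bivector `Λ(g)` translated to the unit by the right translation, as a map `𝔤* → 𝔤`. -/
def BivectorField.atUnit (Λ : BivectorField E G) (g : G) :
    Module.Dual ℝ (GroupLieAlgebra 𝓘(ℝ, E) G) →ₗ[ℝ] GroupLieAlgebra 𝓘(ℝ, E) G :=
  rightTranslateInv g ∘ₗ Λ.sharp g ∘ₗ (rightTranslateInv g).dualMap

/-- A Lie-Poisson structure on a Lie group: a smooth bivector field which is Poisson (its bracket
of functions satisfies the Jacobi identity) and multiplicative,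
`Λ(g h) = (L_g)_* Λ(h) + (R_h)_* Λ(g)`. Smoothness is expressed in the right trivialization of the
tangent bundle. -/
structure IsLiePoisson (Λ : BivectorField E G) : Prop where
  smooth : ∀ ξ ξ' : Module.Dual ℝ (GroupLieAlgebra 𝓘(ℝ, E) G),
    ContMDiff 𝓘(ℝ, E) 𝓘(ℝ, ℝ) ∞ (fun g : G => ξ' (Λ.atUnit g ξ))
  jacobi : ∀ f₁ f₂ f₃ : G → ℝ, ContMDiff 𝓘(ℝ, E) 𝓘(ℝ, ℝ) ∞ f₁ →
    ContMDiff 𝓘(ℝ, E) 𝓘(ℝ, ℝ) ∞ f₂ → ContMDiff 𝓘(ℝ, E) 𝓘(ℝ, ℝ) ∞ f₃ → ∀ x : G,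
    Λ.bracket f₁ (Λ.bracket f₂ f₃) x + Λ.bracket f₂ (Λ.bracket f₃ f₁) x
      + Λ.bracket f₃ (Λ.bracket f₁ f₂) x = 0
  mul : ∀ (g h : G) (α : Module.Dual ℝ (TangentSpace 𝓘(ℝ, E) (g * h))),
    Λ.sharp (g * h) α = dL g h (Λ.sharp h (α ∘ₗ dL g h)) + dR h g (Λ.sharp g (α ∘ₗ dR h g))

/-- The linearization of `Λ` at the unit, as a bilinear bracket on covectors at the unit:
`⟨X, [ξ, ξ']_Λ⟩` is the derivative in the direction `X ∈ 𝔤` of the right translate of `Λ` to the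
unit, evaluated on `ξ` and `ξ'`. For a Lie-Poisson structure, it is the Lie bracket of the dual Lie
algebra `𝔤*`. -/
def BivectorField.linearization (Λ : BivectorField E G)
    (ξ ξ' : Module.Dual ℝ (GroupLieAlgebra 𝓘(ℝ, E) G)) :
    Module.Dual ℝ (GroupLieAlgebra 𝓘(ℝ, E) G) :=
  differential (fun g : G => ξ' (Λ.atUnit g ξ)) 1

end LiePoisson

/-! ### The group double -/

section Double

variable {EG : Type*} [NormedAddCommGroup EG] [NormedSpace ℝ EG]
  {G : Type*} [TopologicalSpace G] [ChartedSpace EG G] [Group G]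
  {ES : Type*} [NormedAddCommGroup ES] [NormedSpace ℝ ES]
  {S : Type*} [TopologicalSpace S] [ChartedSpace ES S] [Group S]

/-- `(S, ΛS)` is a dual group of the Lie-Poisson group `(G, ΛG)`, the Lie algebra of `S` being
identified with `𝔤*` by the pairing `p`: the bracket of `Lie S = 𝔤*` is the linearization of `ΛG`,
and the linearization of the Lie-Poisson structure `ΛS` is the bracket of `𝔤 = (𝔤*)*`. Following
the usual convention, dual groups are connected. -/
structure IsDualGroup (ΛG : BivectorField EG G) (ΛS : BivectorField ES S)
    (p : GroupLieAlgebra 𝓘(ℝ, EG) G →ₗ[ℝ] GroupLieAlgebra 𝓘(ℝ, ES) S →ₗ[ℝ] ℝ) : Prop where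
  connected : ConnectedSpace S
  liePoisson : IsLiePoisson ΛG
  liePoisson_dual : IsLiePoisson ΛS
  perfect : p.IsPerfPair
  bracket_dual : ∀ Y Y' : GroupLieAlgebra 𝓘(ℝ, ES) S,
    p.flip ⁅Y, Y'⁆ = ΛG.linearization (p.flip Y) (p.flip Y')
  bracket : ∀ X X' : GroupLieAlgebra 𝓘(ℝ, EG) G,
    p ⁅X, X'⁆ = ΛS.linearization (p X) (p X')

variable {ED : Type*} [NormedAddCommGroup ED] [NormedSpace ℝ ED]
  {D : Type*} [TopologicalSpace D] [ChartedSpace ED D] [Group D]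

variable (EG ED) in
/-- The differential at the unit of a homomorphism of Lie groups. -/
def lieMap (f : G →* D) : GroupLieAlgebra 𝓘(ℝ, EG) G →ₗ[ℝ] GroupLieAlgebra 𝓘(ℝ, ED) D :=
  (mfderiv 𝓘(ℝ, EG) 𝓘(ℝ, ED) f 1).toLinearMap

variable (ED D) in
/-- A complete group double `D(G, ΛG)` of a Lie-Poisson group `(G, ΛG)` with dual group `(S, ΛS)`:
a Lie group `D` together with homomorphisms `G → D` and `S → D` such that the Lie algebra of `D` is
`𝔤 ⊕ 𝔤*` with `𝔤` and `𝔤* = Lie S` as Lie subalgebras (embedded by the differentials of the two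
homomorphisms), the canonical symmetric pairing of `𝔤 ⊕ 𝔤*` being invariant under the adjoint
action. Completeness means that the group product identifies `G × S` with `D`. -/
structure CompleteDouble (ΛG : BivectorField EG G) (ΛS : BivectorField ES S) where
  /-- the inclusion of `G` -/
  incl : G →* D
  /-- the inclusion of the dual group -/
  inclDual : S →* D
  incl_smooth : ContMDiff 𝓘(ℝ, EG) 𝓘(ℝ, ED) ∞ incl
  inclDual_smooth : ContMDiff 𝓘(ℝ, ES) 𝓘(ℝ, ED) ∞ inclDual
  /-- the pairing between `𝔤` and `Lie S = 𝔤*` -/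
  pairing : GroupLieAlgebra 𝓘(ℝ, EG) G →ₗ[ℝ] GroupLieAlgebra 𝓘(ℝ, ES) S →ₗ[ℝ] ℝ
  isDualGroup : IsDualGroup ΛG ΛS pairing
  decomposition : Function.Bijective ((lieMap EG ED incl).coprod (lieMap ES ED inclDual))
  /-- the canonical symmetric pairing on the Lie algebra of `D` -/
  form : LinearMap.BilinForm ℝ (GroupLieAlgebra 𝓘(ℝ, ED) D)
  form_symm : form.IsSymm
  form_incl : ∀ X X', form (lieMap EG ED incl X) (lieMap EG ED incl X') = 0
  form_inclDual : ∀ Y Y', form (lieMap ES ED inclDual Y) (lieMap ES ED inclDual Y') = 0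
  form_mixed : ∀ X Y, form (lieMap EG ED incl X) (lieMap ES ED inclDual Y) = pairing X Y
  form_invariant : ∀ (d : D) (v w), form (Ad d v) (Ad d w) = form v w
  /-- the identification of `G × S` with `D` -/
  prodDiffeo : Diffeomorph (𝓘(ℝ, EG).prod 𝓘(ℝ, ES)) 𝓘(ℝ, ED) (G × S) D ∞
  prodDiffeo_apply : ∀ (g : G) (u : S), prodDiffeo (g, u) = incl g * inclDual u

namespace CompleteDouble

variable {ΛG : BivectorField EG G} {ΛS : BivectorField ES S} (𝔇 : CompleteDouble ED D ΛG ΛS)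

/-- The bivector `r = ∑ i, X i ∧ Y i` on the Lie algebra of `D`, for dual bases `X` of `𝔤` and `Y`
of `𝔤*`, written without bases as the map `r(a, ·)` on covectors `a`. -/
def rSharp : Module.Dual ℝ (GroupLieAlgebra 𝓘(ℝ, ED) D) →ₗ[ℝ] GroupLieAlgebra 𝓘(ℝ, ED) D :=
  haveI := 𝔇.isDualGroup.perfect
  lieMap ES ED 𝔇.inclDual ∘ₗ 𝔇.pairing.flip.toPerfPair.symm.toLinearMap ∘ₗ (lieMap EG ED 𝔇.incl).dualMap
    - lieMap EG ED 𝔇.incl ∘ₗ 𝔇.pairing.toPerfPair.symm.toLinearMap ∘ₗ (lieMap ES ED 𝔇.inclDual).dualMap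

/-- In dual bases, `r = ∑ i, X i ∧ Y i`. -/
theorem rSharp_eq_sum {ι : Type*} [Fintype ι] [DecidableEq ι]
    (X : Module.Basis ι ℝ (GroupLieAlgebra 𝓘(ℝ, EG) G))
    (Y : Module.Basis ι ℝ (GroupLieAlgebra 𝓘(ℝ, ES) S))
    (hXY : ∀ i j, 𝔇.pairing (X i) (Y j) = if i = j then 1 else 0)
    (a : Module.Dual ℝ (GroupLieAlgebra 𝓘(ℝ, ED) D)) :
    𝔇.rSharp a = ∑ i, (a (lieMap EG ED 𝔇.incl (X i)) • lieMap ES ED 𝔇.inclDual (Y i)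
      - a (lieMap ES ED 𝔇.inclDual (Y i)) • lieMap EG ED 𝔇.incl (X i)) := by
  have := 𝔇.isDualGroup.perfect
  have h1 : 𝔇.pairing.flip.toPerfPair.symm (a ∘ₗ lieMap EG ED 𝔇.incl)
      = ∑ i, a (lieMap EG ED 𝔇.incl (X i)) • Y i := by
    rw [LinearEquiv.symm_apply_eq]
    refine X.ext fun j => ?_
    simp [hXY]
  have h2 : 𝔇.pairing.toPerfPair.symm (a ∘ₗ lieMap ES ED 𝔇.inclDual)
      = ∑ i, a (lieMap ES ED 𝔇.inclDual (Y i)) • X i := by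
    rw [LinearEquiv.symm_apply_eq]
    refine Y.ext fun j => ?_
    simp [hXY]
  have h : 𝔇.rSharp a = lieMap ES ED 𝔇.inclDual (𝔇.pairing.flip.toPerfPair.symm (a ∘ₗ lieMap EG ED 𝔇.incl))
      - lieMap EG ED 𝔇.incl (𝔇.pairing.toPerfPair.symm (a ∘ₗ lieMap ES ED 𝔇.inclDual)) := rfl
  rw [h, h1, h2]
  simp [Finset.sum_sub_distrib]

/-- The natural Poisson tensor `Λ_D^+ = - (r^l + r^r) / 2` on the double, where `r^l` and `r^r` are
the left- and right-invariant bivector fields with value `r = ∑ i, X i ∧ Y i` at the unit; given as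
the map `Λ_D^+(α, ·)` on covectors `α`. -/
def sharpPlus (d : D) (α : Module.Dual ℝ (TangentSpace 𝓘(ℝ, ED) d)) : TangentSpace 𝓘(ℝ, ED) d :=
  -(1 / 2 : ℝ) • (leftTranslate d (𝔇.rSharp (α ∘ₗ leftTranslate d))
    + rightTranslate d (𝔇.rSharp (α ∘ₗ rightTranslate d)))

/-- The momentum map `D ≅ G × S → S`. -/
def momentum (d : D) : S := (𝔇.prodDiffeo.symm d).2

/-- The vector field `Γ_η = Λ_D^+(μ^* η)` on the double, for a 1-form `η` on the dual group. -/
def Gam (η : ∀ u : S, TangentSpace 𝓘(ℝ, ES) u →L[ℝ] ℝ) (d : D) : TangentSpace 𝓘(ℝ, ED) d :=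
  𝔇.sharpPlus d ((η (𝔇.momentum d)).toLinearMap ∘ₗ
    (mfderiv 𝓘(ℝ, ED) 𝓘(ℝ, ES) 𝔇.momentum d).toLinearMap)

end CompleteDouble

/-- The vector field `Λ(η)` on `S`, the contraction of the 1-form `η` with `Λ`. -/
def momentumField (ΛS : BivectorField ES S) (η : ∀ u : S, TangentSpace 𝓘(ℝ, ES) u →L[ℝ] ℝ)
    (u : S) : TangentSpace 𝓘(ℝ, ES) u :=
  ΛS.sharp u (η u).toLinearMap

/-- The function `⟨Y^r, η⟩` on `S`, where `Y^r` is the right-invariant vector field with value `Y`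
at the unit. -/
def pairRight (η : ∀ u : S, TangentSpace 𝓘(ℝ, ES) u →L[ℝ] ℝ) (Y : GroupLieAlgebra 𝓘(ℝ, ES) S)
    (u : S) : ℝ :=
  η u (rightTranslate u Y)

end Double

end PoissonLie

end

/-!
After translation to the unit, the statements become linear algebra in the Lie algebra
`𝔡 = 𝔤 ⊕ 𝔤*` of `D`, with the isotropic subalgebras `𝔤` and `𝔤*`. Tangent spaces are copies of the
model space, so that derivatives are treated as maps of model spaces (`modelDeriv`) and translations
as the maps `trans g h`, the derivatives at the unit of `x ↦ g x h`.

*The Lie-Poisson structure of the dual group.* For `u ∈ G*` and `X ∈ 𝔤`, let `coad u X` and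
`dress u X` be the components of `Ad u⁻¹ X` in `𝔤` and `𝔤*`. In the right trivialization,
`Λ_{G*}(u)` applied to `X ∈ 𝔤 = (𝔤*)*` is `-Ad u (dress u X)` (`atUnitL_pairL`). Indeed both sides
are multiplicative, so their difference `defect` is a cocycle on `G*` (`defect_mul`). Its derivative
at the unit vanishes: the left side has the bracket of `𝔤` as linearization, and so has the right
side, since the derivative of the adjoint action is the bracket (`modelDeriv_adL_apply_one`) and the
form of `𝔡` is invariant (`pairL_modelBracket`). A cocycle with zero derivative at the unit has zero
derivative everywhere, and it vanishes because `G*` is connected.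

*The vector field.* Identifying `𝔡` with its dual by the form, `r` is the difference of the
projections to `𝔤*` and to `𝔤` (`rSharpL_formL`). The covector `μ*η` at `g u` vanishes on vectors
tangent to the cosets `G u`, so that, translated to the unit by `v ↦ g v u`, it is represented by an
element `L` of the isotropic subalgebra `𝔤`, and `L = ∑ ⟨Y_i^r, η⟩(u) X_i`. The left and right
trivializations of `μ*η` are then represented by `Ad u⁻¹ L` and by `Ad g L ∈ 𝔤`, and
`Γ_η` at `g u` is `g L u` minus the left translate of `dress u L` (`gamL_mul`). With the formula for
`Λ_{G*}`, this gives `Γ_η` in the coordinates `(g, u)` (`gamL_prodDiffeo`), and the equations of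
motion follow since `G × G* → D` is a diffeomorphism (`hasModelDerivAt_mul_iff`).

*Quadratures.* Left-invariant vector fields are complete, so that the exponential map is given by
one-parameter groups. If `A` and `B` commute, then `Ad (exp A) B = B`, whence
`exp (A + B) = exp A exp B` and, for a differentiable curve `Z` in a commutative subalgebra,
`exp Z` has the logarithmic derivative `Z'` (`hasLogDerivAt_expL_of_mem`). If `g⁻¹ g' = Z'`, then
`g exp (-Z)` has derivative zero and is constant (`hasLogDerivAt_iff_eq_mul_expL`). Here `Z` is the
integral of the velocities, which stays in the subalgebra (`sum_integral_smul_mem`).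
-/

noncomputable section

namespace PoissonLie

/-! ### Derivatives as maps of the model spaces -/

section ModelDerivative

variable {E : Type*} [NormedAddCommGroup E] [NormedSpace ℝ E]
  {H : Type*} [TopologicalSpace H] {I : ModelWithCorners ℝ E H}
  {M : Type*} [TopologicalSpace M] [ChartedSpace H M]
  {E' : Type*} [NormedAddCommGroup E'] [NormedSpace ℝ E']
  {H' : Type*} [TopologicalSpace H'] {I' : ModelWithCorners ℝ E' H'}
  {M' : Type*} [TopologicalSpace M'] [ChartedSpace H' M']
  {E'' : Type*} [NormedAddCommGroup E''] [NormedSpace ℝ E'']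
  {H'' : Type*} [TopologicalSpace H''] {I'' : ModelWithCorners ℝ E'' H''}
  {M'' : Type*} [TopologicalSpace M''] [ChartedSpace H'' M'']

variable (I I') in
/-- The derivative of a map between manifolds, as a map between the model spaces. Every tangent
space is by definition a copy of the model space; with this form of the derivative, base points that
are only propositionally equal, as `g * 1` and `g`, cause no change of type. -/
def modelDeriv (f : M → M') (x : M) : E →L[ℝ] E' := mfderiv I I' f x

variable (I I') in
/-- The map `f` has derivative `f'` at `x`, where `f'` is a map between the model spaces. -/
def HasModelDerivAt (f : M → M') (x : M) (f' : E →L[ℝ] E') : Prop := HasMFDerivAt I I' f x f'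

theorem hasModelDerivAt_modelDeriv {f : M → M'} {x : M} (hf : MDifferentiableAt I I' f x) :
    HasModelDerivAt I I' f x (modelDeriv I I' f x) := hf.hasMFDerivAt

theorem HasModelDerivAt.modelDeriv_eq {f : M → M'} {x : M} {f' : E →L[ℝ] E'}
    (hf : HasModelDerivAt I I' f x f') : modelDeriv I I' f x = f' := HasMFDerivAt.mfderiv hf

theorem HasModelDerivAt.mdifferentiableAt {f : M → M'} {x : M} {f' : E →L[ℝ] E'}
    (hf : HasModelDerivAt I I' f x f') : MDifferentiableAt I I' f x :=
  HasMFDerivAt.mdifferentiableAt hf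

theorem hasModelDerivAt_id (x : M) :
    HasModelDerivAt I I (fun y : M => y) x (ContinuousLinearMap.id ℝ E) := hasMFDerivAt_id x

theorem hasModelDerivAt_const (c : M') (x : M) :
    HasModelDerivAt I I' (fun _ : M => c) x 0 := hasMFDerivAt_const c x

/-- The chain rule, for a composition known up to pointwise equality. -/
theorem HasModelDerivAt.comp {f : M → M'} {g : M' → M''} {h : M → M''} {x : M} {y : M'}
    {f' : E →L[ℝ] E'} {g' : E' →L[ℝ] E''}
    (hg : HasModelDerivAt I' I'' g y g') (hf : HasModelDerivAt I I' f x f') (hy : f x = y)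
    (hh : ∀ z, g (f z) = h z) : HasModelDerivAt I I'' h x (g' ∘L f') := by
  subst hy
  obtain rfl : g ∘ f = h := funext hh
  exact HasMFDerivAt.comp x hg hf

theorem modelDeriv_comp {f : M → M'} {g : M' → M''} {h : M → M''} {x : M} {y : M'}
    (hf : MDifferentiableAt I I' f x) (hg : MDifferentiableAt I' I'' g y) (hy : f x = y)
    (hh : ∀ z, g (f z) = h z) (v : E) :
    modelDeriv I' I'' g y (modelDeriv I I' f x v) = modelDeriv I I'' h x v := by
  rw [((hasModelDerivAt_modelDeriv hg).comp (hasModelDerivAt_modelDeriv hf) hy hh).modelDeriv_eq]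
  rfl

end ModelDerivative

/-! ### Two-sided translations and the adjoint action -/

section LieGroup

variable {E : Type*} [NormedAddCommGroup E] [NormedSpace ℝ E]
  {G : Type*} [TopologicalSpace G] [ChartedSpace E G] [Group G]

variable (E) in
/-- The adjoint action as a continuous linear map of the model space. -/
def adL (g : G) : E →L[ℝ] E := modelDeriv 𝓘(ℝ, E) 𝓘(ℝ, E) (fun x : G => g * x * g⁻¹) 1

variable (E) in
/-- The derivative at the unit of `x ↦ g x h`, as a map of the model space. -/
def trans (g h : G) : E →L[ℝ] E := modelDeriv 𝓘(ℝ, E) 𝓘(ℝ, E) (fun x : G => g * x * h) 1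

theorem leftTranslate_apply (g : G) (v : GroupLieAlgebra 𝓘(ℝ, E) G) :
    leftTranslate g v = trans E g 1 v := by
  change modelDeriv 𝓘(ℝ, E) 𝓘(ℝ, E) _ _ _ = _
  simp [trans]

theorem rightTranslate_apply (g : G) (v : GroupLieAlgebra 𝓘(ℝ, E) G) :
    rightTranslate g v = trans E 1 g v := by
  change modelDeriv 𝓘(ℝ, E) 𝓘(ℝ, E) _ _ _ = _
  simp [trans]

theorem adL_eq_trans (g : G) : adL E g = trans E g g⁻¹ := rfl

theorem trans_one_one : trans E (1 : G) 1 = ContinuousLinearMap.id ℝ E :=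
  HasModelDerivAt.modelDeriv_eq (by simpa using hasModelDerivAt_id (I := 𝓘(ℝ, E)) (1 : G))

theorem adL_one : adL E (1 : G) = ContinuousLinearMap.id ℝ E := by
  rw [adL_eq_trans, inv_one, trans_one_one]

variable [LieGroup 𝓘(ℝ, E) ∞ G]

theorem contMDiff_mul_mul (g h : G) :
    ContMDiff 𝓘(ℝ, E) 𝓘(ℝ, E) ∞ (fun x : G => g * x * h) :=
  (contMDiff_const.mul contMDiff_id).mul contMDiff_const

theorem mdifferentiableAt_mul_mul (g h x : G) :
    MDifferentiableAt 𝓘(ℝ, E) 𝓘(ℝ, E) (fun x : G => g * x * h) x :=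
  (contMDiff_mul_mul g h).mdifferentiableAt (by simp)

theorem mdifferentiableAt_mul_const (g x : G) :
    MDifferentiableAt 𝓘(ℝ, E) 𝓘(ℝ, E) (fun x : G => x * g) x := by
  simpa using mdifferentiableAt_mul_mul (E := E) 1 g x

theorem mdifferentiableAt_const_mul (g x : G) :
    MDifferentiableAt 𝓘(ℝ, E) 𝓘(ℝ, E) (fun x : G => g * x) x := by
  simpa using mdifferentiableAt_mul_mul (E := E) g 1 x

/-- Two-sided translations compose with conjugations. -/
theorem trans_adL (a b g : G) (v : E) : trans E a b (adL E g v) = trans E (a * g) (g⁻¹ * b) v :=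
  modelDeriv_comp (mdifferentiableAt_mul_mul _ _ _) (mdifferentiableAt_mul_mul _ _ _) (by simp)
    (fun z => by group) v

theorem adL_mul (g h : G) (v : E) : adL E (g * h) v = adL E g (adL E h v) := by
  rw [adL_eq_trans g, trans_adL, adL_eq_trans, mul_inv_rev]

theorem adL_inv_adL (g : G) (v : E) : adL E g⁻¹ (adL E g v) = v := by
  rw [← adL_mul, inv_mul_cancel, adL_one]; rfl

theorem adL_adL_inv (g : G) (v : E) : adL E g (adL E g⁻¹ v) = v := by
  rw [← adL_mul, mul_inv_cancel, adL_one]; rfl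

/-- The product rule in a Lie group. -/
theorem HasModelDerivAt.mul {F : Type*} [NormedAddCommGroup F] [NormedSpace ℝ F]
    {H : Type*} [TopologicalSpace H] {I : ModelWithCorners ℝ F H}
    {M : Type*} [TopologicalSpace M] [ChartedSpace H M] {a b : M → G} {x : M} {a' b' : F →L[ℝ] E}
    (ha : HasModelDerivAt I 𝓘(ℝ, E) a x a') (hb : HasModelDerivAt I 𝓘(ℝ, E) b x b') :
    HasModelDerivAt I 𝓘(ℝ, E) (fun y => a y * b y) x
      (modelDeriv 𝓘(ℝ, E) 𝓘(ℝ, E) (fun y : G => y * b x) (a x) ∘L a'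
        + modelDeriv 𝓘(ℝ, E) 𝓘(ℝ, E) (fun y : G => a x * y) (b x) ∘L b') := by
  have hm : MDifferentiableAt (𝓘(ℝ, E).prod 𝓘(ℝ, E)) 𝓘(ℝ, E) (fun p : G × G => p.1 * p.2)
      (a x, b x) := (contMDiff_mul 𝓘(ℝ, E) ∞).mdifferentiableAt (by simp)
  have hab : HasModelDerivAt I (𝓘(ℝ, E).prod 𝓘(ℝ, E)) (fun y => (a y, b y)) x (a'.prod b') :=
    HasMFDerivAt.prodMk ha hb
  have h := (hasModelDerivAt_modelDeriv hm).comp (h := fun y => a y * b y) hab rfl (fun _ => rfl)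
  convert h using 1
  ext v
  exact (mfderiv_prod_eq_add_apply (v := (a' v, b' v)) hm).symm

theorem hasModelDerivAt_inv_one :
    HasModelDerivAt 𝓘(ℝ, E) 𝓘(ℝ, E) (fun y : G => y⁻¹) 1 (-ContinuousLinearMap.id ℝ E) := by
  have hd : MDifferentiableAt 𝓘(ℝ, E) 𝓘(ℝ, E) (fun y : G => y⁻¹) 1 :=
    (contMDiff_inv 𝓘(ℝ, E) ∞).mdifferentiableAt (by simp)
  have h := hasModelDerivAt_modelDeriv hd
  have h2 := ((hasModelDerivAt_id (I := 𝓘(ℝ, E)) (1 : G)).mul h).modelDeriv_eq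
  have h3 : modelDeriv 𝓘(ℝ, E) 𝓘(ℝ, E) (fun y : G => y * y⁻¹) 1 = 0 := by
    simp only [mul_inv_cancel]
    exact (hasModelDerivAt_const (I := 𝓘(ℝ, E)) (1 : G) (1 : G)).modelDeriv_eq
  rw [h3] at h2
  simp only [inv_one, mul_one, one_mul,
    (hasModelDerivAt_id (I := 𝓘(ℝ, E)) (1 : G)).modelDeriv_eq, ContinuousLinearMap.id_comp] at h2
  rwa [eq_neg_of_add_eq_zero_right h2.symm] at h

/-- The adjoint representation is smooth. -/
theorem contMDiff_adL : ContMDiff 𝓘(ℝ, E) 𝓘(ℝ, E →L[ℝ] E) ∞ (adL E : G → E →L[ℝ] E) := by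
  intro g₀
  have hf : ContMDiff (𝓘(ℝ, E).prod 𝓘(ℝ, E)) 𝓘(ℝ, E) ∞
      (Function.uncurry fun g x : G => g * x * g⁻¹) :=
    (contMDiff_fst.mul contMDiff_snd).mul contMDiff_fst.inv
  have : IsManifold 𝓘(ℝ, E) 1 G := IsManifold.of_le (n := ∞) (by simp)
  have h := ContMDiffAt.mfderiv (x₀ := g₀) (m := ∞) (fun g x : G => g * x * g⁻¹) (fun _ => 1)
    hf.contMDiffAt contMDiffAt_const (by simp)
  refine h.congr_of_eventuallyEq (Filter.Eventually.of_forall fun g => ?_)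
  rw [inTangentCoordinates_eq_mfderiv_comp (by simp) (by simp)]
  -- conjugations fix the unit, where the derivative of the chart is the identity
  have key : ∀ x y : G, x = 1 → y = 1 → modelDeriv 𝓘(ℝ, E) 𝓘(ℝ, E) (extChartAt 𝓘(ℝ, E) x) y
      = ContinuousLinearMap.id ℝ E := by
    rintro _ _ rfl rfl
    exact mfderiv_extChartAt_self
  have h1 := key (g₀ * 1 * g₀⁻¹) (g * 1 * g⁻¹) (by simp) (by simp)
  have h2 := mfderivWithin_range_extChartAt_symm (I := 𝓘(ℝ, E)) (x := (1 : G))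
  ext v
  change _ = modelDeriv 𝓘(ℝ, E) 𝓘(ℝ, E) (extChartAt 𝓘(ℝ, E) (g₀ * 1 * g₀⁻¹)) (g * 1 * g⁻¹)
    (adL E g (mfderivWithin 𝓘(ℝ, E) 𝓘(ℝ, E) (extChartAt 𝓘(ℝ, E) (1 : G)).symm (range 𝓘(ℝ, E))
      (extChartAt 𝓘(ℝ, E) (1 : G) 1) v))
  rw [h1, h2]
  rfl

end LieGroup

/-! ### The derivative of the adjoint action is the Lie bracket -/

section AdjointDerivative

open Filter Topology

variable {E : Type*} [NormedAddCommGroup E] [NormedSpace ℝ E]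
  {G : Type*} [TopologicalSpace G] [ChartedSpace E G] [Group G]

variable (E G) in
/-- The group law in the preferred chart at the unit. -/
def chartMul (z : E × E) : E :=
  extChartAt 𝓘(ℝ, E) (1 : G)
    ((extChartAt 𝓘(ℝ, E) (1 : G)).symm z.1 * (extChartAt 𝓘(ℝ, E) (1 : G)).symm z.2)

variable (E G) in
/-- The coordinate of the unit in the preferred chart at the unit. -/
def chartOne : E := extChartAt 𝓘(ℝ, E) (1 : G) 1

theorem extChartAt_symm_chartOne :
    (extChartAt 𝓘(ℝ, E) (1 : G)).symm (chartOne E G) = 1 := extChartAt_to_inv _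

theorem hasModelDerivAt_extChartAt_symm [IsManifold 𝓘(ℝ, E) 1 G] :
    HasModelDerivAt 𝓘(ℝ, E) 𝓘(ℝ, E) (extChartAt 𝓘(ℝ, E) (1 : G)).symm (chartOne E G)
      (ContinuousLinearMap.id ℝ E) := by
  have h : MDifferentiableAt 𝓘(ℝ, E) 𝓘(ℝ, E) (extChartAt 𝓘(ℝ, E) (1 : G)).symm (chartOne E G) := by
    have := mdifferentiableWithinAt_extChartAt_symm (I := 𝓘(ℝ, E)) (mem_extChartAt_target (1 : G))
    simpa only [modelWithCornersSelf_coe, range_id, mdifferentiableWithinAt_univ, chartOne]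
      using this
  have h2 := mfderivWithin_range_extChartAt_symm (I := 𝓘(ℝ, E)) (x := (1 : G))
  simp only [modelWithCornersSelf_coe, range_id, mfderivWithin_univ] at h2
  have h3 := hasModelDerivAt_modelDeriv h
  have h4 : modelDeriv 𝓘(ℝ, E) 𝓘(ℝ, E) (extChartAt 𝓘(ℝ, E) (1 : G)).symm (chartOne E G)
      = ContinuousLinearMap.id ℝ E := h2
  rwa [h4] at h3

variable [LieGroup 𝓘(ℝ, E) ∞ G]

theorem contDiffAt_chartMul : ContDiffAt ℝ ∞ (chartMul E G) (chartOne E G, chartOne E G) := by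
  have : IsManifold 𝓘(ℝ, E) ∞ G := inferInstance
  have hs : ContMDiffAt 𝓘(ℝ, E) 𝓘(ℝ, E) ∞ (extChartAt 𝓘(ℝ, E) (1 : G)).symm (chartOne E G) :=
    (contMDiffOn_extChartAt_symm 1).contMDiffAt
      ((isOpen_extChartAt_target (1 : G)).mem_nhds (mem_extChartAt_target 1))
  have h1 : ContMDiffAt 𝓘(ℝ, E × E) 𝓘(ℝ, E) ∞
      (fun z : E × E => (extChartAt 𝓘(ℝ, E) (1 : G)).symm z.1) (chartOne E G, chartOne E G) :=
    ContMDiffAt.comp (chartOne E G, chartOne E G) (f := Prod.fst) hs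
      contDiff_fst.contMDiff.contMDiffAt
  have h2 : ContMDiffAt 𝓘(ℝ, E × E) 𝓘(ℝ, E) ∞
      (fun z : E × E => (extChartAt 𝓘(ℝ, E) (1 : G)).symm z.2) (chartOne E G, chartOne E G) :=
    ContMDiffAt.comp (chartOne E G, chartOne E G) (f := Prod.snd) hs
      contDiff_snd.contMDiff.contMDiffAt
  refine ContMDiffAt.contDiffAt (ContMDiffAt.comp _ (I' := 𝓘(ℝ, E)) ?_ (h1.mul h2))
  have := contMDiffAt_extChartAt (I := 𝓘(ℝ, E)) (n := ∞) (x := (1 : G))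
  simpa only [extChartAt_symm_chartOne, mul_one] using this

theorem HasModelDerivAt.hasFDerivAt {F F' : Type*} [NormedAddCommGroup F] [NormedSpace ℝ F]
    [NormedAddCommGroup F'] [NormedSpace ℝ F'] {f : F → F'} {x : F} {f' : F →L[ℝ] F'}
    (h : HasModelDerivAt 𝓘(ℝ, F) 𝓘(ℝ, F') f x f') : HasFDerivAt f f' x :=
  HasMFDerivAt.hasFDerivAt h

/-- The partial derivative of the group law in the second variable is the left translation, read in
the chart. -/
theorem fderiv_chartMul_inr {x : E} (hx : x ∈ (extChartAt 𝓘(ℝ, E) (1 : G)).target)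
    (hd : DifferentiableAt ℝ (chartMul E G) (x, chartOne E G)) (v : E) :
    fderiv ℝ (chartMul E G) (x, chartOne E G) (0, v)
      = modelDeriv 𝓘(ℝ, E) 𝓘(ℝ, E) (extChartAt 𝓘(ℝ, E) (1 : G))
          ((extChartAt 𝓘(ℝ, E) (1 : G)).symm x)
          (trans E ((extChartAt 𝓘(ℝ, E) (1 : G)).symm x) 1 v) := by
  have : IsManifold 𝓘(ℝ, E) 1 G := IsManifold.of_le (n := ∞) (by simp)
  set g := (extChartAt 𝓘(ℝ, E) (1 : G)).symm x with hg
  have hφ : MDifferentiableAt 𝓘(ℝ, E) 𝓘(ℝ, E) (extChartAt 𝓘(ℝ, E) (1 : G)) g :=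
    mdifferentiableAt_extChartAt (by
      rw [← extChartAt_source 𝓘(ℝ, E)]
      exact (extChartAt 𝓘(ℝ, E) (1 : G)).map_target hx)
  have h1 := (hasModelDerivAt_modelDeriv (mdifferentiableAt_mul_mul (E := E) g 1 1)).comp
    hasModelDerivAt_extChartAt_symm extChartAt_symm_chartOne (fun _ => rfl)
  have h2 := (hasModelDerivAt_modelDeriv hφ).comp h1
    (by simp only [extChartAt_symm_chartOne, mul_one])
    (h := fun y => chartMul E G (x, y)) (fun _ => by simp only [chartMul, ← hg, mul_one])
  have h3 := hd.hasFDerivAt.comp _ (hasFDerivAt_prodMk_right x (chartOne E G))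
  exact congrArg (fun f : E →L[ℝ] E => f v) (h3.unique h2.hasFDerivAt)

/-- The partial derivative of the group law in the first variable is the right translation, read in
the chart. -/
theorem fderiv_chartMul_inl {x : E} (hx : x ∈ (extChartAt 𝓘(ℝ, E) (1 : G)).target)
    (hd : DifferentiableAt ℝ (chartMul E G) (chartOne E G, x)) (v : E) :
    fderiv ℝ (chartMul E G) (chartOne E G, x) (v, 0)
      = modelDeriv 𝓘(ℝ, E) 𝓘(ℝ, E) (extChartAt 𝓘(ℝ, E) (1 : G))
          ((extChartAt 𝓘(ℝ, E) (1 : G)).symm x)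
          (trans E 1 ((extChartAt 𝓘(ℝ, E) (1 : G)).symm x) v) := by
  have : IsManifold 𝓘(ℝ, E) 1 G := IsManifold.of_le (n := ∞) (by simp)
  set g := (extChartAt 𝓘(ℝ, E) (1 : G)).symm x with hg
  have hφ : MDifferentiableAt 𝓘(ℝ, E) 𝓘(ℝ, E) (extChartAt 𝓘(ℝ, E) (1 : G)) g :=
    mdifferentiableAt_extChartAt (by
      rw [← extChartAt_source 𝓘(ℝ, E)]
      exact (extChartAt 𝓘(ℝ, E) (1 : G)).map_target hx)
  have h1 := (hasModelDerivAt_modelDeriv (mdifferentiableAt_mul_mul (E := E) 1 g 1)).comp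
    hasModelDerivAt_extChartAt_symm extChartAt_symm_chartOne (fun _ => rfl)
  have h2 := (hasModelDerivAt_modelDeriv hφ).comp h1
    (by simp only [extChartAt_symm_chartOne, mul_one, one_mul])
    (h := fun y => chartMul E G (y, x)) (fun _ => by simp only [chartMul, ← hg, one_mul])
  have h3 := HasFDerivAt.comp (f := fun y : E => (y, x)) (chartOne E G) hd.hasFDerivAt
    (hasFDerivAt_prodMk_left (chartOne E G) x)
  exact congrArg (fun f : E →L[ℝ] E => f v) (h3.unique h2.hasFDerivAt)

theorem eventually_differentiableAt_chartMul :
    ∀ᶠ z in 𝓝 (chartOne E G, chartOne E G), DifferentiableAt ℝ (chartMul E G) z := by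
  filter_upwards [((contDiffAt_chartMul (E := E) (G := G)).of_le (m := 1) (by simp)).eventually
    (by simp)] with z hz
  exact hz.differentiableAt (by simp)

variable (E G) in
/-- A left-invariant vector field, read in the preferred chart at the unit. -/
def chartField (v : E) : E → E :=
  VectorField.mpullbackWithin 𝓘(ℝ, E) 𝓘(ℝ, E) (extChartAt 𝓘(ℝ, E) (1 : G)).symm
    (mulInvariantVectorField (v : GroupLieAlgebra 𝓘(ℝ, E) G)) (range 𝓘(ℝ, E))

/-- Near the unit, the left-invariant vector fields in the chart are partial derivatives of the
group law. -/
theorem chartField_eventuallyEq (v : E) :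
    chartField E G v
      =ᶠ[𝓝 (chartOne E G)] fun x => fderiv ℝ (chartMul E G) (x, chartOne E G) (0, v) := by
  have : IsManifold 𝓘(ℝ, E) 1 G := IsManifold.of_le (n := ∞) (by simp)
  have hc : ContinuousAt (fun x : E => (x, chartOne E G)) (chartOne E G) := by fun_prop
  filter_upwards [(isOpen_extChartAt_target (I := 𝓘(ℝ, E)) (1 : G)).mem_nhds
    (mem_extChartAt_target 1), hc.eventually eventually_differentiableAt_chartMul] with x hx hd
  rw [fderiv_chartMul_inr hx hd]
  have hl : (mulInvariantVectorField (v : GroupLieAlgebra 𝓘(ℝ, E) G)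
      ((extChartAt 𝓘(ℝ, E) (1 : G)).symm x) : E)
      = trans E ((extChartAt 𝓘(ℝ, E) (1 : G)).symm x) 1 v :=
    leftTranslate_apply _ v
  rw [← hl]
  exact congrArg (fun f : E →L[ℝ] E => f _) (ContinuousLinearMap.inverse_eq
    (mfderivWithin_extChartAt_symm_comp_mfderiv_extChartAt hx)
    (mfderiv_extChartAt_comp_mfderivWithin_extChartAt_symm hx))

/-- Near the unit, the left-invariant vector fields in the chart are related to the right-invariant
ones by the adjoint action. -/
theorem fderiv_chartMul_eventuallyEq (v : E) :
    (fun x => fderiv ℝ (chartMul E G) (x, chartOne E G) (0, v)) =ᶠ[𝓝 (chartOne E G)]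
      fun x => fderiv ℝ (chartMul E G) (chartOne E G, x)
        (adL E ((extChartAt 𝓘(ℝ, E) (1 : G)).symm x) v, 0) := by
  have hc : ContinuousAt (fun x : E => (x, chartOne E G)) (chartOne E G) := by fun_prop
  have hc' : ContinuousAt (fun x : E => (chartOne E G, x)) (chartOne E G) := by fun_prop
  filter_upwards [(isOpen_extChartAt_target (I := 𝓘(ℝ, E)) (1 : G)).mem_nhds
    (mem_extChartAt_target 1), hc.eventually eventually_differentiableAt_chartMul,
    hc'.eventually eventually_differentiableAt_chartMul] with x hx hd hd'
  rw [fderiv_chartMul_inr hx hd, fderiv_chartMul_inl hx hd', trans_adL]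
  simp

theorem fderiv_chartMul_one_inr (w : E) :
    fderiv ℝ (chartMul E G) (chartOne E G, chartOne E G) (0, w) = w := by
  have : IsManifold 𝓘(ℝ, E) 1 G := IsManifold.of_le (n := ∞) (by simp)
  have h := fderiv_chartMul_inr (mem_extChartAt_target (1 : G))
    (eventually_differentiableAt_chartMul (E := E) (G := G)).self_of_nhds w
  have h1 := extChartAt_symm_chartOne (E := E) (G := G)
  rw [chartOne] at h1
  rw [h1, trans_one_one] at h
  exact h.trans (congrArg (fun f : E →L[ℝ] E => f w)
    (mfderiv_extChartAt_self (I := 𝓘(ℝ, E)) (x := (1 : G))))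

theorem fderiv_chartMul_one_inl (w : E) :
    fderiv ℝ (chartMul E G) (chartOne E G, chartOne E G) (w, 0) = w := by
  have : IsManifold 𝓘(ℝ, E) 1 G := IsManifold.of_le (n := ∞) (by simp)
  have h := fderiv_chartMul_inl (mem_extChartAt_target (1 : G))
    (eventually_differentiableAt_chartMul (E := E) (G := G)).self_of_nhds w
  have h1 := extChartAt_symm_chartOne (E := E) (G := G)
  rw [chartOne] at h1
  rw [h1, trans_one_one] at h
  exact h.trans (congrArg (fun f : E →L[ℝ] E => f w)
    (mfderiv_extChartAt_self (I := 𝓘(ℝ, E)) (x := (1 : G))))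

variable (G) in
/-- The bracket of the Lie algebra, on the model space. -/
def modelBracket (Y v : E) : E :=
  Bracket.bracket (L := GroupLieAlgebra 𝓘(ℝ, E) G) (M := GroupLieAlgebra 𝓘(ℝ, E) G) Y v

/-- The Lie bracket in the chart: the skew part of the second derivative of the group law. -/
theorem modelBracket_eq_fderiv (Y v : E) :
    modelBracket G Y v =
      fderiv ℝ (fun x => fderiv ℝ (chartMul E G) (x, chartOne E G) (0, v)) (chartOne E G) Y
      - fderiv ℝ (fun x => fderiv ℝ (chartMul E G) (x, chartOne E G) (0, Y)) (chartOne E G) v := by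
  have : IsManifold 𝓘(ℝ, E) 1 G := IsManifold.of_le (n := ∞) (by simp)
  have hv := chartField_eventuallyEq (G := G) v
  have hY := chartField_eventuallyEq (G := G) Y
  have h : modelBracket G Y v
      = VectorField.lieBracket ℝ (chartField E G Y) (chartField E G v) (chartOne E G) := by
    have h1 : modelBracket G Y v
        = (modelDeriv 𝓘(ℝ, E) 𝓘(ℝ, E) (extChartAt 𝓘(ℝ, E) (1 : G)) 1).inverse
        (VectorField.lieBracketWithin ℝ (chartField E G Y) (chartField E G v)
          (range 𝓘(ℝ, E)) (chartOne E G)) := by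
      rw [← univ_inter (range 𝓘(ℝ, E))]
      rfl
    have h2 : modelDeriv 𝓘(ℝ, E) 𝓘(ℝ, E) (extChartAt 𝓘(ℝ, E) (1 : G)) 1
        = ContinuousLinearMap.id ℝ E := mfderiv_extChartAt_self
    rw [h1, h2, ContinuousLinearMap.inverse_id, modelWithCornersSelf_coe, range_id,
      VectorField.lieBracketWithin_univ]
    rfl
  rw [h, VectorField.lieBracket, hv.fderiv_eq, hY.fderiv_eq, hv.self_of_nhds,
    hY.self_of_nhds]
  beta_reduce
  rw [fderiv_chartMul_one_inr, fderiv_chartMul_one_inr]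

theorem mdifferentiableAt_adL_apply (v : E) (g : G) :
    MDifferentiableAt 𝓘(ℝ, E) 𝓘(ℝ, E) (fun g : G => adL E g v) g :=
  (contMDiff_adL.clm_apply contMDiff_const).contMDiffAt.mdifferentiableAt (n := ∞) (by simp)

/-- The derivative of the adjoint action at the unit is the Lie bracket. -/
theorem modelDeriv_adL_apply_one (Y v : E) :
    modelDeriv 𝓘(ℝ, E) 𝓘(ℝ, E) (fun g : G => adL E g v) 1 Y = modelBracket G Y v := by
  have : IsManifold 𝓘(ℝ, E) 1 G := IsManifold.of_le (n := ∞) (by simp)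
  set e := chartOne E G with he
  have hF : DifferentiableAt ℝ (fderiv ℝ (chartMul E G)) (e, e) :=
    (contDiffAt_chartMul.fderiv_right (n := ∞) (m := 1) (by
      rw [one_add_one_eq_two]
      exact ENat.LEInfty.out)).differentiableAt (by simp)
  set T := fderiv ℝ (fderiv ℝ (chartMul E G)) (e, e) with hT
  have hsymm : ∀ z w, T z w = T w z :=
    (contDiffAt_chartMul (E := E) (G := G)).isSymmSndFDerivAt
      (by simp only [minSmoothness_of_isRCLikeNormedField]; exact ENat.LEInfty.out)
  have hA' := ((hasModelDerivAt_modelDeriv (mdifferentiableAt_adL_apply v 1)).comp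
    (hasModelDerivAt_extChartAt_symm (E := E) (G := G)) extChartAt_symm_chartOne
    (fun _ => rfl)).hasFDerivAt
  -- the left-invariant field as a partial derivative in the second variable
  have hl : ∀ w : E, HasFDerivAt (fun x => fderiv ℝ (chartMul E G) (x, e) (0, w))
      ((T ∘L ContinuousLinearMap.inl ℝ E E).flip (0, w)) e := by
    intro w
    have h1 := HasFDerivAt.comp (f := fun y : E => (y, e)) e hF.hasFDerivAt
      (hasFDerivAt_prodMk_left e e)
    have := h1.clm_apply (hasFDerivAt_const ((0, w) : E × E) e)
    simpa using this
  -- the same field through the derivative in the first variable and the adjoint action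
  have hr := (hF.hasFDerivAt.comp e (hasFDerivAt_prodMk_right e e)).clm_apply
    (hA'.prodMk (hasFDerivAt_const (0 : E) e))
  have huniq := ((fderiv_chartMul_eventuallyEq (G := G) v).hasFDerivAt_iff.1 (hl v)).unique hr
  have h2 := congrArg (fun f : E →L[ℝ] E => f Y) huniq
  simp only [ContinuousLinearMap.flip_apply, ContinuousLinearMap.comp_apply,
    add_apply, ContinuousLinearMap.inl_apply, ContinuousLinearMap.inr_apply,
    ContinuousLinearMap.prod_apply, Function.comp_apply, he, extChartAt_symm_chartOne, adL_one,
    ContinuousLinearMap.id_apply, zero_apply, fderiv_chartMul_one_inl] at h2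
  rw [modelBracket_eq_fderiv, (hl v).fderiv, (hl Y).fderiv]
  simp only [ContinuousLinearMap.flip_apply, ContinuousLinearMap.comp_apply,
    ContinuousLinearMap.inl_apply]
  rw [hsymm (v, 0) (0, Y), hT, h2]
  abel

end AdjointDerivative

/-! ### Functions with zero derivative -/

section ZeroDerivative

open Filter Topology

variable {E : Type*} [NormedAddCommGroup E] [NormedSpace ℝ E]
  {M : Type*} [TopologicalSpace M] [ChartedSpace E M] [IsManifold 𝓘(ℝ, E) 1 M]

/-- A real function with vanishing derivative on a connected manifold is constant. -/
theorem eq_of_hasModelDerivAt_zero [PreconnectedSpace M] {f : M → ℝ}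
    (hf : ∀ x, HasModelDerivAt 𝓘(ℝ, E) 𝓘(ℝ, ℝ) f x 0) (x y : M) : f x = f y := by
  refine IsLocallyConstant.apply_eq_of_preconnectedSpace ?_ x y
  refine (IsLocallyConstant.iff_eventually_eq f).2 fun x => ?_
  set φ := extChartAt 𝓘(ℝ, E) x with hφ
  obtain ⟨ε, hε, hball⟩ := Metric.isOpen_iff.1 (isOpen_extChartAt_target (I := 𝓘(ℝ, E)) x) (φ x)
    (mem_extChartAt_target x)
  have hderiv : ∀ z ∈ Metric.ball (φ x) ε, HasFDerivAt (f ∘ φ.symm) (0 : E →L[ℝ] ℝ) z := by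
    intro z hz
    have hs : MDifferentiableAt 𝓘(ℝ, E) 𝓘(ℝ, E) φ.symm z := by
      have := mdifferentiableWithinAt_extChartAt_symm (I := 𝓘(ℝ, E)) (hball hz)
      simpa only [modelWithCornersSelf_coe, range_id, mdifferentiableWithinAt_univ] using this
    have := (hf (φ.symm z)).comp (hasModelDerivAt_modelDeriv hs) rfl (h := f ∘ φ.symm)
      (fun _ => rfl)
    simpa using this.hasFDerivAt
  have hconst : ∀ z ∈ Metric.ball (φ x) ε, f (φ.symm z) = f (φ.symm (φ x)) := fun z hz =>
    (convex_ball (φ x) ε).is_const_of_fderivWithin_eq_zero (𝕜 := ℝ) (f := f ∘ φ.symm)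
      (fun z hz => (hderiv z hz).differentiableAt.differentiableWithinAt)
      (fun z hz => ((hderiv z hz).hasFDerivWithinAt).fderivWithin
        (Metric.isOpen_ball.uniqueDiffWithinAt hz)) hz (Metric.mem_ball_self hε)
  have hc : ∀ᶠ y in 𝓝 x, φ y ∈ Metric.ball (φ x) ε :=
    (continuousAt_extChartAt x).eventually (Metric.ball_mem_nhds _ hε)
  filter_upwards [hc, extChartAt_source_mem_nhds (I := 𝓘(ℝ, E)) x] with y hy hy'
  have := hconst (φ y) hy
  rwa [φ.left_inv hy', φ.left_inv (mem_extChartAt_source x)] at this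

end ZeroDerivative

/-! ### Homomorphisms of Lie groups -/

section Hom

variable {E : Type*} [NormedAddCommGroup E] [NormedSpace ℝ E]
  {G : Type*} [TopologicalSpace G] [ChartedSpace E G] [Group G]
  {E' : Type*} [NormedAddCommGroup E'] [NormedSpace ℝ E']
  {D : Type*} [TopologicalSpace D] [ChartedSpace E' D] [Group D] [LieGroup 𝓘(ℝ, E') ∞ D]

/-- The derivative at the unit of `h ↦ Ad (f h) v`, for a homomorphism `f`. -/
theorem hasModelDerivAt_adL_hom {f : G →* D} (hf : ContMDiff 𝓘(ℝ, E) 𝓘(ℝ, E') ∞ f) (v : E') :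
    ∃ A : E →L[ℝ] E', HasModelDerivAt 𝓘(ℝ, E) 𝓘(ℝ, E') (fun g : G => adL E' (f g) v) 1 A ∧
      ∀ Y, A Y = modelBracket D (modelDeriv 𝓘(ℝ, E) 𝓘(ℝ, E') f 1 Y) v :=
  ⟨_, (hasModelDerivAt_modelDeriv (mdifferentiableAt_adL_apply v 1)).comp
    (hasModelDerivAt_modelDeriv (hf.mdifferentiableAt (by simp))) (map_one f) (fun _ => rfl),
    fun Y => modelDeriv_adL_apply_one _ v⟩

variable [LieGroup 𝓘(ℝ, E) ∞ G]

theorem modelBracket_swap (Y v : E) : modelBracket G Y v = -modelBracket G v Y := by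
  rw [modelBracket_eq_fderiv, modelBracket_eq_fderiv, neg_sub]

/-- The derivative at the unit of a homomorphism intertwines the adjoint actions. -/
theorem modelDeriv_hom_adL {f : G →* D} (hf : ContMDiff 𝓘(ℝ, E) 𝓘(ℝ, E') ∞ f) (g : G) (X : E) :
    modelDeriv 𝓘(ℝ, E) 𝓘(ℝ, E') f 1 (adL E g X)
      = adL E' (f g) (modelDeriv 𝓘(ℝ, E) 𝓘(ℝ, E') f 1 X) := by
  have hd : MDifferentiableAt 𝓘(ℝ, E) 𝓘(ℝ, E') f 1 := hf.mdifferentiableAt (by simp)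
  rw [adL, adL, modelDeriv_comp (mdifferentiableAt_mul_mul _ _ _) hd (by simp) (fun _ => rfl),
    modelDeriv_comp hd (mdifferentiableAt_mul_mul _ _ _) (by simp) (fun _ => rfl)]
  simp

theorem hasModelDerivAt_adL_hom_inv {f : G →* D} (hf : ContMDiff 𝓘(ℝ, E) 𝓘(ℝ, E') ∞ f) (v : E') :
    ∃ A : E →L[ℝ] E', HasModelDerivAt 𝓘(ℝ, E) 𝓘(ℝ, E') (fun g : G => adL E' (f g)⁻¹ v) 1 A ∧
      ∀ Y, A Y = -modelBracket D (modelDeriv 𝓘(ℝ, E) 𝓘(ℝ, E') f 1 Y) v := by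
  obtain ⟨A, hA, hA'⟩ := hasModelDerivAt_adL_hom hf v
  refine ⟨_, hA.comp hasModelDerivAt_inv_one inv_one (fun z => by rw [map_inv]), fun Y => ?_⟩
  simp [hA']

/-- The derivative at the unit of a homomorphism of Lie groups preserves the bracket. -/
theorem modelDeriv_hom_modelBracket {f : G →* D} (hf : ContMDiff 𝓘(ℝ, E) 𝓘(ℝ, E') ∞ f)
    (Y X : E) :
    modelDeriv 𝓘(ℝ, E) 𝓘(ℝ, E') f 1 (modelBracket G Y X)
      = modelBracket D (modelDeriv 𝓘(ℝ, E) 𝓘(ℝ, E') f 1 Y)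
          (modelDeriv 𝓘(ℝ, E) 𝓘(ℝ, E') f 1 X) := by
  obtain ⟨A, hA, hA'⟩ := hasModelDerivAt_adL_hom hf (modelDeriv 𝓘(ℝ, E) 𝓘(ℝ, E') f 1 X)
  have h1 : HasModelDerivAt 𝓘(ℝ, E) 𝓘(ℝ, E') (modelDeriv 𝓘(ℝ, E) 𝓘(ℝ, E') f 1)
      (adL E (1 : G) X) (modelDeriv 𝓘(ℝ, E) 𝓘(ℝ, E') f 1) :=
    (ContinuousLinearMap.hasFDerivAt _).hasMFDerivAt
  have h2 := h1.comp (hasModelDerivAt_modelDeriv (mdifferentiableAt_adL_apply X (1 : G))) rfl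
    (h := fun g : G => adL E' (f g) (modelDeriv 𝓘(ℝ, E) 𝓘(ℝ, E') f 1 X))
    (fun g => modelDeriv_hom_adL hf g X)
  rw [← hA', ← modelDeriv_adL_apply_one, ← hA.modelDeriv_eq, h2.modelDeriv_eq]
  rfl

end Hom

/-! ### Lie-Poisson structures and the double, on model spaces -/

section Double

variable {EG : Type*} [NormedAddCommGroup EG] [NormedSpace ℝ EG]
  {G : Type*} [TopologicalSpace G] [ChartedSpace EG G] [Group G]
  {ES : Type*} [NormedAddCommGroup ES] [NormedSpace ℝ ES]
  {S : Type*} [TopologicalSpace S] [ChartedSpace ES S] [Group S]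
  {ED : Type*} [NormedAddCommGroup ED] [NormedSpace ℝ ED]
  {D : Type*} [TopologicalSpace D] [ChartedSpace ED D] [Group D]

/-- The bivector translated to the unit, on model spaces. -/
def BivectorField.atUnitL (Λ : BivectorField ES S) (u : S) : Module.Dual ℝ ES →ₗ[ℝ] ES :=
  Λ.atUnit u

/-- The map `Λ(u, ·)` on covectors, on model spaces. -/
def BivectorField.sharpL (Λ : BivectorField ES S) (u : S) : Module.Dual ℝ ES →ₗ[ℝ] ES := Λ.sharp u

/-- The derivative at `u` of the right translation by `u⁻¹`, on model spaces. -/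
def rightInvL (u : S) : ES →L[ℝ] ES :=
  modelDeriv 𝓘(ℝ, ES) 𝓘(ℝ, ES) (fun x : S => x * u⁻¹) u

theorem BivectorField.atUnitL_eq (Λ : BivectorField ES S) (u : S) (ξ : Module.Dual ℝ ES) :
    Λ.atUnitL u ξ = rightInvL u (Λ.sharpL u (ξ ∘ₗ (rightInvL u).toLinearMap)) := rfl

theorem IsLiePoisson.sharpL_mul {Λ : BivectorField ES S} (hΛ : IsLiePoisson Λ) (g h : S)
    (α : Module.Dual ℝ ES) :
    Λ.sharpL (g * h) α
      = modelDeriv 𝓘(ℝ, ES) 𝓘(ℝ, ES) (fun x : S => g * x) h (Λ.sharpL h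
          (α ∘ₗ (modelDeriv 𝓘(ℝ, ES) 𝓘(ℝ, ES) (fun x : S => g * x) h).toLinearMap))
        + modelDeriv 𝓘(ℝ, ES) 𝓘(ℝ, ES) (fun x : S => x * h) g (Λ.sharpL g
          (α ∘ₗ (modelDeriv 𝓘(ℝ, ES) 𝓘(ℝ, ES) (fun x : S => x * h) g).toLinearMap)) :=
  hΛ.mul g h α

section Multiplicative

variable [LieGroup 𝓘(ℝ, ES) ∞ S]

theorem trans_rightInvL (u : S) (v : ES) : trans ES 1 u (rightInvL u v) = v := by
  have h := modelDeriv_comp (mdifferentiableAt_mul_const (E := ES) u⁻¹ u)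
    (mdifferentiableAt_mul_mul (E := ES) 1 u (1 : S)) (by simp) (h := fun x => x) (by simp) v
  rwa [(hasModelDerivAt_id (I := 𝓘(ℝ, ES)) u).modelDeriv_eq] at h

/-- A bivector field is recovered from its right trivialization. -/
theorem BivectorField.sharpL_eq (Λ : BivectorField ES S) (u : S) (α : Module.Dual ℝ ES) :
    Λ.sharpL u α = trans ES 1 u (Λ.atUnitL u (α ∘ₗ (trans ES 1 u).toLinearMap)) := by
  have h : (α ∘ₗ (trans ES 1 u).toLinearMap) ∘ₗ (rightInvL u).toLinearMap = α :=
    LinearMap.ext fun v => congrArg α (trans_rightInvL u v)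
  rw [Λ.atUnitL_eq, h, trans_rightInvL]

/-- In the right trivialization, a multiplicative bivector field is a cocycle for the adjoint
action. -/
theorem IsLiePoisson.atUnitL_mul {Λ : BivectorField ES S} (hΛ : IsLiePoisson Λ) (g h : S)
    (ξ : Module.Dual ℝ ES) :
    Λ.atUnitL (g * h) ξ
      = adL ES g (Λ.atUnitL h (ξ ∘ₗ (adL ES g).toLinearMap)) + Λ.atUnitL g ξ := by
  have hl : ∀ v : ES, rightInvL (g * h)
      (modelDeriv 𝓘(ℝ, ES) 𝓘(ℝ, ES) (fun x : S => g * x) h v) = adL ES g (rightInvL h v) := by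
    intro v
    rw [adL, rightInvL, rightInvL, modelDeriv_comp (mdifferentiableAt_const_mul _ _)
      (mdifferentiableAt_mul_const _ _) rfl (fun _ => rfl),
      modelDeriv_comp (mdifferentiableAt_mul_const _ _)
      (mdifferentiableAt_mul_mul _ _ _) (by simp) (fun _ => rfl)]
    congr 3
    funext x
    group
  have hr : ∀ v : ES, rightInvL (g * h)
      (modelDeriv 𝓘(ℝ, ES) 𝓘(ℝ, ES) (fun x : S => x * h) g v) = rightInvL g v := by
    intro v
    rw [rightInvL, rightInvL, modelDeriv_comp (mdifferentiableAt_mul_const _ _)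
      (mdifferentiableAt_mul_const _ _) rfl (fun _ => rfl)]
    congr 3
    funext x
    group
  have hm := hΛ.sharpL_mul g h (ξ ∘ₗ (rightInvL (g * h)).toLinearMap)
  have h1 : (ξ ∘ₗ (rightInvL (g * h)).toLinearMap) ∘ₗ
      (modelDeriv 𝓘(ℝ, ES) 𝓘(ℝ, ES) (fun x : S => g * x) h).toLinearMap
      = (ξ ∘ₗ (adL ES g).toLinearMap) ∘ₗ (rightInvL h).toLinearMap :=
    LinearMap.ext fun v => congrArg ξ (hl v)
  have h2 : (ξ ∘ₗ (rightInvL (g * h)).toLinearMap) ∘ₗ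
      (modelDeriv 𝓘(ℝ, ES) 𝓘(ℝ, ES) (fun x : S => x * h) g).toLinearMap
      = ξ ∘ₗ (rightInvL g).toLinearMap :=
    LinearMap.ext fun v => congrArg ξ (hr v)
  rw [Λ.atUnitL_eq, Λ.atUnitL_eq, Λ.atUnitL_eq, hm, map_add, hl, hr, h1, h2]

end Multiplicative

namespace CompleteDouble

variable {ΛG : BivectorField EG G} {ΛS : BivectorField ES S} (𝔇 : CompleteDouble ED D ΛG ΛS)

/-- The inclusion of `𝔤` in the Lie algebra of the double, on model spaces. -/
def inclL : EG →L[ℝ] ED := modelDeriv 𝓘(ℝ, EG) 𝓘(ℝ, ED) 𝔇.incl 1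

/-- The inclusion of `𝔤*` in the Lie algebra of the double, on model spaces. -/
def dualL : ES →L[ℝ] ED := modelDeriv 𝓘(ℝ, ES) 𝓘(ℝ, ED) 𝔇.inclDual 1

/-- The symmetric pairing on the Lie algebra of the double, on model spaces. -/
def formL : ED →ₗ[ℝ] ED →ₗ[ℝ] ℝ := 𝔇.form

/-- The pairing of `𝔤` and `𝔤*`, on model spaces. -/
def pairL : EG →ₗ[ℝ] ES →ₗ[ℝ] ℝ := 𝔇.pairing

theorem formL_symm (v w : ED) : 𝔇.formL v w = 𝔇.formL w v := 𝔇.form_symm.eq v w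

theorem formL_incl (X X' : EG) : 𝔇.formL (𝔇.inclL X) (𝔇.inclL X') = 0 := 𝔇.form_incl X X'

theorem formL_dual (Y Y' : ES) : 𝔇.formL (𝔇.dualL Y) (𝔇.dualL Y') = 0 := 𝔇.form_inclDual Y Y'

theorem formL_mixed (X : EG) (Y : ES) : 𝔇.formL (𝔇.inclL X) (𝔇.dualL Y) = 𝔇.pairL X Y :=
  𝔇.form_mixed X Y

theorem formL_adL (d : D) (v w : ED) : 𝔇.formL (adL ED d v) (adL ED d w) = 𝔇.formL v w :=
  𝔇.form_invariant d v w

/-- The decomposition of the Lie algebra of the double as `𝔤 ⊕ 𝔤*`. -/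
def splitL : (EG × ES) ≃ₗ[ℝ] ED :=
  LinearEquiv.ofBijective (𝔇.inclL.toLinearMap.coprod 𝔇.dualL.toLinearMap) 𝔇.decomposition

/-- The component in `𝔤` of an element of the Lie algebra of the double. -/
def projG : ED →ₗ[ℝ] EG := LinearMap.fst ℝ EG ES ∘ₗ 𝔇.splitL.symm.toLinearMap

/-- The component in `𝔤*` of an element of the Lie algebra of the double. -/
def projS : ED →ₗ[ℝ] ES := LinearMap.snd ℝ EG ES ∘ₗ 𝔇.splitL.symm.toLinearMap

theorem inclL_projG_add (w : ED) : 𝔇.inclL (𝔇.projG w) + 𝔇.dualL (𝔇.projS w) = w :=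
  𝔇.splitL.apply_symm_apply w

theorem splitL_symm_add (A : EG) (B : ES) :
    𝔇.splitL.symm (𝔇.inclL A + 𝔇.dualL B) = (A, B) :=
  𝔇.splitL.symm_apply_apply (A, B)

theorem projG_add (A : EG) (B : ES) : 𝔇.projG (𝔇.inclL A + 𝔇.dualL B) = A :=
  congrArg Prod.fst (𝔇.splitL_symm_add A B)

theorem projS_add (A : EG) (B : ES) : 𝔇.projS (𝔇.inclL A + 𝔇.dualL B) = B :=
  congrArg Prod.snd (𝔇.splitL_symm_add A B)

theorem projS_inclL (A : EG) : 𝔇.projS (𝔇.inclL A) = 0 := by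
  simpa using 𝔇.projS_add A 0

theorem projG_inclL (A : EG) : 𝔇.projG (𝔇.inclL A) = A := by
  simpa using 𝔇.projG_add A 0

theorem formL_inclL_left (A : EG) (w : ED) :
    𝔇.formL (𝔇.inclL A) w = 𝔇.pairL A (𝔇.projS w) := by
  conv_lhs => rw [← 𝔇.inclL_projG_add w, map_add, formL_incl, formL_mixed, zero_add]

theorem formL_dualL_right (w : ED) (B : ES) :
    𝔇.formL w (𝔇.dualL B) = 𝔇.pairL (𝔇.projG w) B := by
  conv_lhs => rw [← 𝔇.inclL_projG_add w, map_add, LinearMap.add_apply, formL_dual, formL_mixed,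
    add_zero]

theorem eq_of_pairL_left {Z Z' : ES} (h : ∀ X, 𝔇.pairL X Z = 𝔇.pairL X Z') : Z = Z' := by
  have hp := 𝔇.isDualGroup.perfect
  exact hp.bijective_right.1 (LinearMap.ext h)

/-- The component in `𝔤` of `Ad u⁻¹ X`: the coadjoint action of the dual group on `𝔤 = (𝔤*)*`. -/
def coad (u : S) : EG →ₗ[ℝ] EG :=
  𝔇.projG ∘ₗ (adL ED (𝔇.inclDual u)⁻¹).toLinearMap ∘ₗ 𝔇.inclL.toLinearMap

/-- The component in `𝔤*` of `Ad u⁻¹ X`. -/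
def dress (u : S) : EG →ₗ[ℝ] ES :=
  𝔇.projS ∘ₗ (adL ED (𝔇.inclDual u)⁻¹).toLinearMap ∘ₗ 𝔇.inclL.toLinearMap

theorem adL_inv_inclL (u : S) (X : EG) :
    adL ED (𝔇.inclDual u)⁻¹ (𝔇.inclL X) = 𝔇.inclL (𝔇.coad u X) + 𝔇.dualL (𝔇.dress u X) :=
  (𝔇.inclL_projG_add _).symm

variable [LieGroup 𝓘(ℝ, ES) ∞ S] [LieGroup 𝓘(ℝ, ED) ∞ D]

theorem dualL_adL (u : S) (Z : ES) :
    𝔇.dualL (adL ES u Z) = adL ED (𝔇.inclDual u) (𝔇.dualL Z) :=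
  modelDeriv_hom_adL 𝔇.inclDual_smooth u Z

/-- On `𝔤 = (𝔤*)*`, the map `coad u` is the transpose of `Ad u`, by the invariance of the form. -/
theorem pairL_coad (u : S) (X : EG) (Z : ES) :
    𝔇.pairL (𝔇.coad u X) Z = 𝔇.pairL X (adL ES u Z) := by
  rw [← formL_mixed, ← formL_mixed, dualL_adL, ← 𝔇.formL_adL (𝔇.inclDual u)⁻¹ (𝔇.inclL X),
    adL_inv_adL, adL_inv_inclL,
    map_add, LinearMap.add_apply, formL_dual, add_zero, formL_mixed]

theorem adL_inv_inclL_mul (g h : S) (X : EG) :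
    adL ED (𝔇.inclDual (g * h))⁻¹ (𝔇.inclL X)
      = 𝔇.inclL (𝔇.coad h (𝔇.coad g X))
        + 𝔇.dualL (𝔇.dress h (𝔇.coad g X) + adL ES h⁻¹ (𝔇.dress g X)) := by
  rw [map_mul, mul_inv_rev, adL_mul, adL_inv_inclL, map_add, adL_inv_inclL, map_add, dualL_adL,
    map_inv, add_assoc]

theorem coad_mul (g h : S) (X : EG) : 𝔇.coad (g * h) X = 𝔇.coad h (𝔇.coad g X) := by
  rw [← 𝔇.projG_add (𝔇.coad h (𝔇.coad g X)), ← adL_inv_inclL_mul]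
  rfl

/-- The map `dress` is a cocycle for the coadjoint action. -/
theorem dress_mul (g h : S) (X : EG) :
    𝔇.dress (g * h) X = 𝔇.dress h (𝔇.coad g X) + adL ES h⁻¹ (𝔇.dress g X) := by
  rw [← 𝔇.projS_add (𝔇.coad h (𝔇.coad g X)) (_ + _), ← adL_inv_inclL_mul]
  rfl

/-- The difference of `ΛS` and of the bivector field given by the double, in the right
trivialization and evaluated on two elements of `𝔤 = (𝔤*)*`. -/
def defect (X X' : EG) (u : S) : ℝ :=
  𝔇.pairL X' (ΛS.atUnitL u (𝔇.pairL X)) + 𝔇.pairL (𝔇.coad u X') (𝔇.dress u X)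

/-- The defect is a cocycle, since both bivector fields are multiplicative. -/
theorem defect_mul (X X' : EG) (g h : S) :
    𝔇.defect X X' (g * h) = 𝔇.defect (𝔇.coad g X) (𝔇.coad g X') h + 𝔇.defect X X' g := by
  have h1 : 𝔇.pairL X ∘ₗ (adL ES g).toLinearMap = 𝔇.pairL (𝔇.coad g X) :=
    LinearMap.ext fun Z => (𝔇.pairL_coad g X Z).symm
  have h2 : 𝔇.pairL (𝔇.coad h (𝔇.coad g X')) (adL ES h⁻¹ (𝔇.dress g X))
      = 𝔇.pairL (𝔇.coad g X') (𝔇.dress g X) := by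
    rw [pairL_coad, adL_adL_inv]
  rw [defect, defect, defect, 𝔇.isDualGroup.liePoisson_dual.atUnitL_mul, h1, map_add, coad_mul,
    dress_mul, map_add, h2, ← pairL_coad]
  ring

end CompleteDouble
end Double

/-! ### The Lie-Poisson structure of the dual group in the double -/

section Calculus

variable {E : Type*} [NormedAddCommGroup E] [NormedSpace ℝ E]
  {H : Type*} [TopologicalSpace H] {I : ModelWithCorners ℝ E H}
  {M : Type*} [TopologicalSpace M] [ChartedSpace H M]
  {F₁ F₂ F₃ : Type*} [NormedAddCommGroup F₁] [NormedSpace ℝ F₁]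
  [NormedAddCommGroup F₂] [NormedSpace ℝ F₂] [NormedAddCommGroup F₃] [NormedSpace ℝ F₃]

theorem HasModelDerivAt.clm_comp (L : F₁ →L[ℝ] F₂) {a : M → F₁} {x : M} {a' : E →L[ℝ] F₁}
    (ha : HasModelDerivAt I 𝓘(ℝ, F₁) a x a') :
    HasModelDerivAt I 𝓘(ℝ, F₂) (fun y => L (a y)) x (L ∘L a') := by
  have h : HasModelDerivAt 𝓘(ℝ, F₁) 𝓘(ℝ, F₂) L (a x) L := L.hasFDerivAt.hasMFDerivAt
  exact h.comp ha rfl (fun _ => rfl)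

theorem HasModelDerivAt.bilin (B : F₁ →L[ℝ] F₂ →L[ℝ] F₃) {a : M → F₁} {b : M → F₂} {x : M}
    {a' : E →L[ℝ] F₁} {b' : E →L[ℝ] F₂} (ha : HasModelDerivAt I 𝓘(ℝ, F₁) a x a')
    (hb : HasModelDerivAt I 𝓘(ℝ, F₂) b x b') :
    HasModelDerivAt I 𝓘(ℝ, F₃) (fun y => B (a y) (b y)) x
      (B (a x) ∘L b' + B.flip (b x) ∘L a') := by
  have h : HasModelDerivAt 𝓘(ℝ, F₁ × F₂) 𝓘(ℝ, F₃) (fun p : F₁ × F₂ => B p.1 p.2) (a x, b x) _ :=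
    (B.isBoundedBilinearMap.hasFDerivAt (a x, b x)).hasMFDerivAt
  have hab : HasModelDerivAt I 𝓘(ℝ, F₁ × F₂) (fun y => (a y, b y)) x (a'.prod b') :=
    ⟨ha.1.prodMk hb.1, ha.2.prodMk hb.2⟩
  convert h.comp hab rfl (fun _ => rfl) using 1
  ext v
  simp

theorem HasModelDerivAt.add {a b : M → F₁} {x : M} {a' b' : E →L[ℝ] F₁}
    (ha : HasModelDerivAt I 𝓘(ℝ, F₁) a x a') (hb : HasModelDerivAt I 𝓘(ℝ, F₁) b x b') :
    HasModelDerivAt I 𝓘(ℝ, F₁) (fun y => a y + b y) x (a' + b') :=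
  HasMFDerivAt.add ha hb

end Calculus

namespace CompleteDouble

variable {EG : Type*} [NormedAddCommGroup EG] [NormedSpace ℝ EG]
  {G : Type*} [TopologicalSpace G] [ChartedSpace EG G] [Group G]
  {ES : Type*} [NormedAddCommGroup ES] [NormedSpace ℝ ES]
  {S : Type*} [TopologicalSpace S] [ChartedSpace ES S] [Group S]
  {ED : Type*} [NormedAddCommGroup ED] [NormedSpace ℝ ED]
  {D : Type*} [TopologicalSpace D] [ChartedSpace ED D] [Group D]
  {ΛG : BivectorField EG G} {ΛS : BivectorField ES S} (𝔇 : CompleteDouble ED D ΛG ΛS)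

section Infinitesimal

/-- The bracket of `𝔤` is the linearization of `ΛS` at the unit. -/
theorem pairL_modelBracket_eq_linearization (X X' : EG) (Y : ES) :
    𝔇.pairL (modelBracket G X X') Y = modelDeriv 𝓘(ℝ, ES) 𝓘(ℝ, ℝ)
      (fun u : S => 𝔇.pairL X' (ΛS.atUnitL u (𝔇.pairL X))) 1 Y :=
  congrArg (fun ξ : Module.Dual ℝ ES => ξ Y) (𝔇.isDualGroup.bracket X X')

theorem contMDiff_atUnitL (X X' : EG) : ContMDiff 𝓘(ℝ, ES) 𝓘(ℝ, ℝ) ∞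
    (fun u : S => 𝔇.pairL X' (ΛS.atUnitL u (𝔇.pairL X))) :=
  𝔇.isDualGroup.liePoisson_dual.smooth (𝔇.pairL X) (𝔇.pairL X')

theorem coad_one (X : EG) : 𝔇.coad 1 X = X := by
  have h : 𝔇.coad 1 X = 𝔇.projG (adL ED (𝔇.inclDual 1)⁻¹ (𝔇.inclL X)) := rfl
  rw [h, map_one, inv_one, adL_one]
  exact 𝔇.projG_inclL X

theorem dress_one (X : EG) : 𝔇.dress 1 X = 0 := by
  have h : 𝔇.dress 1 X = 𝔇.projS (adL ED (𝔇.inclDual 1)⁻¹ (𝔇.inclL X)) := rfl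
  rw [h, map_one, inv_one, adL_one]
  exact 𝔇.projS_inclL X

variable [LieGroup 𝓘(ℝ, ED) ∞ D]

/-- The infinitesimal invariance of the symmetric pairing. -/
theorem formL_modelBracket [FiniteDimensional ℝ ED] (Z v w : ED) :
    𝔇.formL (modelBracket D Z v) w + 𝔇.formL v (modelBracket D Z w) = 0 := by
  have hv := hasModelDerivAt_modelDeriv (mdifferentiableAt_adL_apply v (1 : D))
  have hw := hasModelDerivAt_modelDeriv (mdifferentiableAt_adL_apply w (1 : D))
  have h := (HasModelDerivAt.bilin 𝔇.formL.toContinuousBilinearMap hv hw).modelDeriv_eq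
  have hc : (fun d : D => 𝔇.formL.toContinuousBilinearMap (adL ED d v) (adL ED d w))
      = fun _ => 𝔇.formL v w := funext fun d => 𝔇.formL_adL d v w
  rw [hc, (hasModelDerivAt_const _ _).modelDeriv_eq] at h
  have h2 := congrArg (fun f : ED →L[ℝ] ℝ => f Z) h
  simp only [adL_one, add_apply, ContinuousLinearMap.comp_apply,
    modelDeriv_adL_apply_one, ContinuousLinearMap.flip_apply, ContinuousLinearMap.id_apply,
    LinearMap.toContinuousBilinearMap_apply, zero_apply] at h2
  rw [add_comm, ← h2]

/-- The bracket of `𝔤` in terms of the mixed brackets of the double, by invariance of the form. -/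
theorem pairL_modelBracket [FiniteDimensional ℝ ED] [LieGroup 𝓘(ℝ, EG) ∞ G] (X X' : EG) (Y : ES) :
    𝔇.pairL (modelBracket G X X') Y
      = 𝔇.pairL X' (𝔇.projS (modelBracket D (𝔇.dualL Y) (𝔇.inclL X))) := by
  have h := 𝔇.formL_modelBracket (𝔇.inclL X) (𝔇.inclL X') (𝔇.dualL Y)
  have h2 : 𝔇.inclL (modelBracket G X X') = modelBracket D (𝔇.inclL X) (𝔇.inclL X') :=
    modelDeriv_hom_modelBracket 𝔇.incl_smooth X X'
  rw [← h2, formL_mixed, modelBracket_swap (𝔇.inclL X) (𝔇.dualL Y), map_neg,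
    formL_inclL_left] at h
  linarith

variable [LieGroup 𝓘(ℝ, EG) ∞ G] [LieGroup 𝓘(ℝ, ES) ∞ S]
variable [FiniteDimensional ℝ EG] [FiniteDimensional ℝ ES] [FiniteDimensional ℝ ED]

/-- Both bivector fields have the bracket of `𝔤` as linearization at the unit. -/
theorem hasModelDerivAt_defect_one (X X' : EG) :
    HasModelDerivAt 𝓘(ℝ, ES) 𝓘(ℝ, ℝ) (𝔇.defect X X') 1 0 := by
  obtain ⟨A, hA, hA'⟩ := hasModelDerivAt_adL_hom_inv 𝔇.inclDual_smooth (𝔇.inclL X)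
  obtain ⟨B, hB, -⟩ := hasModelDerivAt_adL_hom_inv 𝔇.inclDual_smooth (𝔇.inclL X')
  have h1 := hasModelDerivAt_modelDeriv
    ((𝔇.contMDiff_atUnitL X X').mdifferentiableAt (x := 1) (by simp))
  have h2 := HasModelDerivAt.bilin 𝔇.pairL.toContinuousBilinearMap
    (hB.clm_comp 𝔇.projG.toContinuousLinearMap) (hA.clm_comp 𝔇.projS.toContinuousLinearMap)
  have h3 : HasModelDerivAt 𝓘(ℝ, ES) 𝓘(ℝ, ℝ) (𝔇.defect X X') 1 _ := h1.add h2
  convert h3 using 1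
  ext Y
  have e1 : 𝔇.projG (adL ED (𝔇.inclDual 1)⁻¹ (𝔇.inclL X')) = X' := 𝔇.coad_one X'
  have e2 : 𝔇.projS (adL ED (𝔇.inclDual 1)⁻¹ (𝔇.inclL X)) = 0 := 𝔇.dress_one X
  have e3 : A Y = -modelBracket D (𝔇.dualL Y) (𝔇.inclL X) := hA' Y
  simp only [add_apply, ContinuousLinearMap.comp_apply,
    LinearMap.toContinuousBilinearMap_apply, LinearMap.coe_toContinuousLinearMap',
    zero_apply, e1, e2, e3, map_neg, map_zero, ← pairL_modelBracket_eq_linearization,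
    pairL_modelBracket]
  ring

/-- The cocycle `defect` has zero derivative at the unit, so it vanishes on the connected group. -/
theorem defect_eq_zero (X X' : EG) (u : S) : 𝔇.defect X X' u = 0 := by
  have := 𝔇.isDualGroup.connected
  have : IsManifold 𝓘(ℝ, ES) 1 S := IsManifold.of_le (n := ∞) (by simp)
  have hderiv : ∀ g, HasModelDerivAt 𝓘(ℝ, ES) 𝓘(ℝ, ℝ) (𝔇.defect X X') g 0 := by
    intro g
    have h1 := (𝔇.hasModelDerivAt_defect_one (𝔇.coad g X) (𝔇.coad g X')).add
      (hasModelDerivAt_const (𝔇.defect X X' g) (1 : S))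
    have h2 := h1.comp (hasModelDerivAt_modelDeriv (mdifferentiableAt_const_mul (E := ES) g⁻¹ g))
      (inv_mul_cancel g) (h := 𝔇.defect X X')
      (fun z => by rw [← defect_mul, mul_inv_cancel_left])
    simpa using h2
  rw [eq_of_hasModelDerivAt_zero hderiv u 1]
  have h := 𝔇.defect_mul X X' 1 1
  rw [coad_one, coad_one, mul_one] at h
  linarith

/-- The Lie-Poisson structure of the dual group in terms of the adjoint action of the double. -/
theorem atUnitL_pairL (u : S) (X : EG) :
    ΛS.atUnitL u (𝔇.pairL X) = -adL ES u (𝔇.dress u X) := by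
  refine 𝔇.eq_of_pairL_left fun X' => ?_
  have h := 𝔇.defect_eq_zero X X' u
  rw [defect, pairL_coad] at h
  rw [map_neg]
  linarith

end Infinitesimal

end CompleteDouble

/-! ### The vector field `Γ_η` -/

/-- A 1-form, with values in the dual of the model space. -/
def modelForm {E : Type*} [NormedAddCommGroup E] [NormedSpace ℝ E] {M : Type*} [TopologicalSpace M]
    [ChartedSpace E M] (η : ∀ u : M, TangentSpace 𝓘(ℝ, E) u →L[ℝ] ℝ) (u : M) : E →L[ℝ] ℝ := η u

namespace CompleteDouble

variable {EG : Type*} [NormedAddCommGroup EG] [NormedSpace ℝ EG]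
  {G : Type*} [TopologicalSpace G] [ChartedSpace EG G] [Group G]
  {ES : Type*} [NormedAddCommGroup ES] [NormedSpace ℝ ES]
  {S : Type*} [TopologicalSpace S] [ChartedSpace ES S] [Group S]
  {ED : Type*} [NormedAddCommGroup ED] [NormedSpace ℝ ED]
  {D : Type*} [TopologicalSpace D] [ChartedSpace ED D] [Group D]
  {ΛG : BivectorField EG G} {ΛS : BivectorField ES S} (𝔇 : CompleteDouble ED D ΛG ΛS)

/-- The bivector `r` at the unit, on model spaces. -/
def rSharpL : Module.Dual ℝ ED →ₗ[ℝ] ED := 𝔇.rSharp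

/-- Under the identification of the Lie algebra of the double with its dual by the symmetric
pairing, `r` is the difference of the projections to `𝔤*` and to `𝔤`. -/
theorem rSharpL_formL (w : ED) :
    𝔇.rSharpL (𝔇.formL w) = 𝔇.dualL (𝔇.projS w) - 𝔇.inclL (𝔇.projG w) := by
  have hp := 𝔇.isDualGroup.perfect
  have h1 : 𝔇.pairing.flip.toPerfPair.symm (𝔇.formL w ∘ₗ 𝔇.inclL.toLinearMap) = 𝔇.projS w := by
    refine (LinearEquiv.symm_apply_eq _).2 (LinearMap.ext fun X => ?_)
    exact (𝔇.formL_symm w (𝔇.inclL X)).trans (𝔇.formL_inclL_left X w)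
  have h2 : 𝔇.pairing.toPerfPair.symm (𝔇.formL w ∘ₗ 𝔇.dualL.toLinearMap) = 𝔇.projG w := by
    refine (LinearEquiv.symm_apply_eq _).2 (LinearMap.ext fun Y => ?_)
    exact 𝔇.formL_dualL_right w Y
  exact congrArg₂ (fun (a : ES) (b : EG) => 𝔇.dualL a - 𝔇.inclL b) h1 h2

/-- The derivative of the momentum map, on model spaces. -/
def momentumDeriv (d : D) : ED →L[ℝ] ES := modelDeriv 𝓘(ℝ, ED) 𝓘(ℝ, ES) 𝔇.momentum d

/-- The vector field `Γ_η` on model spaces. -/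
def gamL (η : ∀ u : S, TangentSpace 𝓘(ℝ, ES) u →L[ℝ] ℝ) (d : D) : ED := 𝔇.Gam η d

theorem momentum_mul (g : G) (u : S) : 𝔇.momentum (𝔇.incl g * 𝔇.inclDual u) = u := by
  rw [← 𝔇.prodDiffeo_apply, momentum, 𝔇.prodDiffeo.symm_apply_apply]

theorem mdifferentiableAt_incl (g : G) : MDifferentiableAt 𝓘(ℝ, EG) 𝓘(ℝ, ED) 𝔇.incl g :=
  𝔇.incl_smooth.mdifferentiableAt (by simp)

theorem mdifferentiableAt_inclDual (u : S) :
    MDifferentiableAt 𝓘(ℝ, ES) 𝓘(ℝ, ED) 𝔇.inclDual u :=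
  𝔇.inclDual_smooth.mdifferentiableAt (by simp)

theorem mdifferentiableAt_momentum (d : D) :
    MDifferentiableAt 𝓘(ℝ, ED) 𝓘(ℝ, ES) 𝔇.momentum d := by
  have h : ContMDiff 𝓘(ℝ, ED) 𝓘(ℝ, ES) ∞ 𝔇.momentum :=
    contMDiff_snd.comp 𝔇.prodDiffeo.symm.contMDiff
  exact h.mdifferentiableAt (by simp)

/-- The definition of `Γ_η` in terms of two-sided translations. -/
theorem gamL_eq (η : ∀ u : S, TangentSpace 𝓘(ℝ, ES) u →L[ℝ] ℝ) (d : D) (α : Module.Dual ℝ ED)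
    (hα : ∀ v, α v = modelForm η (𝔇.momentum d) (𝔇.momentumDeriv d v)) :
    𝔇.gamL η d = -(1 / 2 : ℝ) • (trans ED d 1 (𝔇.rSharpL (α ∘ₗ (trans ED d 1).toLinearMap))
      + trans ED 1 d (𝔇.rSharpL (α ∘ₗ (trans ED 1 d).toLinearMap))) := by
  obtain rfl : α = (modelForm η (𝔇.momentum d)).toLinearMap ∘ₗ
    (𝔇.momentumDeriv d).toLinearMap := LinearMap.ext hα
  have hl : trans ED d 1 = modelDeriv 𝓘(ℝ, ED) 𝓘(ℝ, ED) (fun x : D => d * x) 1 := by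
    simp [trans]
  have hr : trans ED 1 d = modelDeriv 𝓘(ℝ, ED) 𝓘(ℝ, ED) (fun x : D => x * d) 1 := by
    simp [trans]
  rw [hl, hr]
  rfl

variable [LieGroup 𝓘(ℝ, ED) ∞ D]

/-- The momentum map is constant along the cosets `G u`. -/
theorem momentumDeriv_trans_inclL (g : G) (u : S) (A : EG) :
    𝔇.momentumDeriv (𝔇.incl g * 𝔇.inclDual u)
      (trans ED (𝔇.incl g) (𝔇.inclDual u) (𝔇.inclL A)) = 0 := by
  rw [trans, inclL, momentumDeriv, modelDeriv_comp (mdifferentiableAt_mul_mul _ _ _)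
    (𝔇.mdifferentiableAt_momentum _) (by simp) (fun _ => rfl),
    modelDeriv_comp (h := fun _ => u) (𝔇.mdifferentiableAt_incl 1) _ (map_one _) (fun h => ?_),
    (hasModelDerivAt_const u (1 : G)).modelDeriv_eq]
  · rfl
  · exact (𝔇.mdifferentiableAt_momentum _).comp 1 (mdifferentiableAt_mul_mul _ _ _)
  · rw [← map_mul, momentum_mul]

/-- The momentum map is `g v ↦ v` on the cosets of the dual group. -/
theorem momentumDeriv_trans_dualL (g : G) (u : S) (B : ES) :
    𝔇.momentumDeriv (𝔇.incl g * 𝔇.inclDual u)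
      (trans ED (𝔇.incl g) (𝔇.inclDual u) (𝔇.dualL B)) = trans ES 1 u B := by
  rw [trans, dualL, momentumDeriv, modelDeriv_comp (mdifferentiableAt_mul_mul _ _ _)
    (𝔇.mdifferentiableAt_momentum _) (by simp) (fun _ => rfl),
    modelDeriv_comp (h := fun h => 1 * h * u) (𝔇.mdifferentiableAt_inclDual 1) _ (map_one _)
      (fun h => ?_)]
  · rfl
  · exact (𝔇.mdifferentiableAt_momentum _).comp 1 (mdifferentiableAt_mul_mul _ _ _)
  · rw [mul_assoc, ← map_mul, momentum_mul, one_mul]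

variable [LieGroup 𝓘(ℝ, EG) ∞ G]

/-- The vector field `Γ_η` at `g u`, by the decomposition of `Ad u⁻¹ L` for the element `L` of `𝔤`
that represents `η` in the right trivialization. -/
theorem gamL_mul (η : ∀ u : S, TangentSpace 𝓘(ℝ, ES) u →L[ℝ] ℝ) (g : G) (u : S) (L : EG)
    (hL : ∀ Y : ES, 𝔇.pairL L Y = modelForm η u (trans ES 1 u Y)) :
    𝔇.gamL η (𝔇.incl g * 𝔇.inclDual u)
      = trans ED (𝔇.incl g) (𝔇.inclDual u) (𝔇.inclL L)
        - trans ED (𝔇.incl g * 𝔇.inclDual u) 1 (𝔇.dualL (𝔇.dress u L)) := by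
  set a := 𝔇.incl g with ha
  set b := 𝔇.inclDual u with hb
  obtain ⟨α, hα⟩ : ∃ α : Module.Dual ℝ ED, ∀ v,
      α v = modelForm η (𝔇.momentum (a * b)) (𝔇.momentumDeriv (a * b) v) :=
    ⟨(modelForm η (𝔇.momentum (a * b))).toLinearMap ∘ₗ
      (𝔇.momentumDeriv (a * b)).toLinearMap, fun _ => rfl⟩
  rw [𝔇.gamL_eq η (a * b) α hα]
  simp only [ha, hb, momentum_mul] at hα
  simp only [← ha, ← hb] at hα
  -- the covector in the two-sided trivialization is represented by `L`
  have hmid : ∀ w, α (trans ED a b w) = 𝔇.formL (𝔇.inclL L) w := by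
    intro w
    rw [← 𝔇.inclL_projG_add w, map_add, map_add, map_add, formL_incl, formL_mixed, hα, hα,
      momentumDeriv_trans_inclL, momentumDeriv_trans_dualL, map_zero, hL]
  have hr : α ∘ₗ (trans ED 1 (a * b)).toLinearMap = 𝔇.formL (adL ED a (𝔇.inclL L)) := by
    refine LinearMap.ext fun v => ?_
    have h : trans ED 1 (a * b) v = trans ED a b (adL ED a⁻¹ v) := by rw [trans_adL]; simp
    have h2 := hmid (adL ED a⁻¹ v)
    rw [← 𝔇.formL_adL a, adL_adL_inv, ← h] at h2
    exact h2
  have hl : α ∘ₗ (trans ED (a * b) 1).toLinearMap = 𝔇.formL (adL ED b⁻¹ (𝔇.inclL L)) := by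
    refine LinearMap.ext fun v => ?_
    have h : trans ED (a * b) 1 v = trans ED a b (adL ED b v) := by rw [trans_adL]; simp
    have h2 := hmid (adL ED b v)
    rw [← 𝔇.formL_adL b⁻¹, adL_inv_adL, ← h] at h2
    exact h2
  have hg : adL ED a (𝔇.inclL L) = 𝔇.inclL (adL EG g L) :=
    (modelDeriv_hom_adL 𝔇.incl_smooth g L).symm
  have e1 : trans ED 1 (a * b) (adL ED a (𝔇.inclL L)) = trans ED a b (𝔇.inclL L) := by
    rw [trans_adL]; simp
  have e2 : trans ED (a * b) 1 (adL ED b⁻¹ (𝔇.inclL L)) = trans ED a b (𝔇.inclL L) := by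
    rw [trans_adL]; simp
  have hs : 𝔇.projS (adL ED b⁻¹ (𝔇.inclL L)) = 𝔇.dress u L := rfl
  have hc : 𝔇.projG (adL ED b⁻¹ (𝔇.inclL L)) = 𝔇.coad u L := rfl
  rw [hr, hl, rSharpL_formL, rSharpL_formL, hs, hc, hg, projS_inclL, projG_inclL, ← hg, map_zero,
    zero_sub, map_neg, e1]
  rw [𝔇.adL_inv_inclL, map_add] at e2
  rw [← e2, map_sub]
  module

variable [LieGroup 𝓘(ℝ, ES) ∞ S]

/-- The derivative of the identification `G × S ≅ D`, on model spaces. -/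
theorem modelDeriv_prodDiffeo (g : G) (u : S) (A : EG) (B : ES) :
    modelDeriv (𝓘(ℝ, EG).prod 𝓘(ℝ, ES)) 𝓘(ℝ, ED) 𝔇.prodDiffeo (g, u)
      (trans EG g 1 A, trans ES u 1 B)
      = trans ED (𝔇.incl g) (𝔇.inclDual u) (𝔇.inclL A)
        + trans ED (𝔇.incl g * 𝔇.inclDual u) 1 (𝔇.dualL B) := by
  have hd : MDifferentiableAt (𝓘(ℝ, EG).prod 𝓘(ℝ, ES)) 𝓘(ℝ, ED) 𝔇.prodDiffeo (g, u) :=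
    𝔇.prodDiffeo.contMDiff.mdifferentiableAt (by simp)
  have h1 : modelDeriv (𝓘(ℝ, EG).prod 𝓘(ℝ, ES)) 𝓘(ℝ, ED) 𝔇.prodDiffeo (g, u)
      (trans EG g 1 A, trans ES u 1 B)
      = modelDeriv 𝓘(ℝ, EG) 𝓘(ℝ, ED) (fun x : G => 𝔇.prodDiffeo (x, u)) g (trans EG g 1 A)
        + modelDeriv 𝓘(ℝ, ES) 𝓘(ℝ, ED) (fun x : S => 𝔇.prodDiffeo (g, x)) u (trans ES u 1 B) :=
    mfderiv_prod_eq_add_apply (v := (trans EG g 1 A, trans ES u 1 B)) hd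
  rw [h1]
  simp only [prodDiffeo_apply]
  congr 1
  · rw [trans, trans, inclL, modelDeriv_comp (mdifferentiableAt_mul_mul _ _ _)
      (f := fun x : G => g * x * 1) (g := fun x : G => 𝔇.incl x * 𝔇.inclDual u) _ (by simp)
      (fun _ => rfl),
      modelDeriv_comp (𝔇.mdifferentiableAt_incl 1) (mdifferentiableAt_mul_mul _ _ _) (map_one _)
      (fun _ => rfl)]
    · simp
    · exact (mdifferentiableAt_mul_const _ _).comp g (𝔇.mdifferentiableAt_incl g)
  · rw [trans, trans, dualL, modelDeriv_comp (mdifferentiableAt_mul_mul _ _ _)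
      (f := fun x : S => u * x * 1) (g := fun x : S => 𝔇.incl g * 𝔇.inclDual x) _ (by simp)
      (fun _ => rfl),
      modelDeriv_comp (𝔇.mdifferentiableAt_inclDual 1) (mdifferentiableAt_mul_mul _ _ _)
      (map_one _) (fun _ => rfl)]
    · simp [mul_assoc]
    · exact (mdifferentiableAt_const_mul _ _).comp u (𝔇.mdifferentiableAt_inclDual u)

variable [FiniteDimensional ℝ EG] [FiniteDimensional ℝ ES] [FiniteDimensional ℝ ED]

/-- The contraction of a covector on the dual group with its Lie-Poisson structure. -/
theorem sharpL_eq_dress (u : S) (L : EG) (ξ : Module.Dual ℝ ES)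
    (hL : ∀ Y : ES, 𝔇.pairL L Y = ξ (trans ES 1 u Y)) :
    ΛS.sharpL u ξ = trans ES u 1 (-𝔇.dress u L) := by
  have h : ξ ∘ₗ (trans ES 1 u).toLinearMap = 𝔇.pairL L := LinearMap.ext fun Y => (hL Y).symm
  rw [BivectorField.sharpL_eq, h, atUnitL_pairL, ← map_neg, trans_adL]
  simp

/-- The vector field `Γ_η` in the coordinates `(g, u)`. -/
theorem gamL_prodDiffeo (η : ∀ u : S, TangentSpace 𝓘(ℝ, ES) u →L[ℝ] ℝ) (g : G) (u : S) (L : EG)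
    (hL : ∀ Y : ES, 𝔇.pairL L Y = modelForm η u (trans ES 1 u Y)) :
    𝔇.gamL η (𝔇.prodDiffeo (g, u))
      = modelDeriv (𝓘(ℝ, EG).prod 𝓘(ℝ, ES)) 𝓘(ℝ, ED) 𝔇.prodDiffeo (g, u)
          (trans EG g 1 L, ΛS.sharpL u (modelForm η u).toLinearMap) := by
  rw [prodDiffeo_apply, 𝔇.gamL_mul η g u L hL, 𝔇.sharpL_eq_dress u L _ hL, modelDeriv_prodDiffeo,
    map_neg, map_neg, sub_eq_add_neg]

/-- A product curve is an integral curve of `Γ_η` if and only if its factors solve the equations of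
motion. -/
theorem hasModelDerivAt_mul_iff (η : ∀ u : S, TangentSpace 𝓘(ℝ, ES) u →L[ℝ] ℝ)
    (g : ℝ → G) (u : ℝ → S) (t : ℝ) (L : EG)
    (hL : ∀ Y : ES, 𝔇.pairL L Y = modelForm η (u t) (trans ES 1 (u t) Y)) :
    HasModelDerivAt 𝓘(ℝ, ℝ) 𝓘(ℝ, ED) (fun t => 𝔇.incl (g t) * 𝔇.inclDual (u t)) t
        ((1 : ℝ →L[ℝ] ℝ).smulRight (𝔇.gamL η (𝔇.incl (g t) * 𝔇.inclDual (u t)))) ↔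
      HasModelDerivAt 𝓘(ℝ, ℝ) 𝓘(ℝ, ES) u t
        ((1 : ℝ →L[ℝ] ℝ).smulRight (ΛS.sharpL (u t) (modelForm η (u t)).toLinearMap)) ∧
      HasModelDerivAt 𝓘(ℝ, ℝ) 𝓘(ℝ, EG) g t
        ((1 : ℝ →L[ℝ] ℝ).smulRight (trans EG (g t) 1 L)) := by
  set P := modelDeriv (𝓘(ℝ, EG).prod 𝓘(ℝ, ES)) 𝓘(ℝ, ED) 𝔇.prodDiffeo (g t, u t) with hP
  set V := ΛS.sharpL (u t) (modelForm η (u t)).toLinearMap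
  have hΓ : 𝔇.gamL η (𝔇.incl (g t) * 𝔇.inclDual (u t)) = P (trans EG (g t) 1 L, V) := by
    rw [← 𝔇.prodDiffeo_apply, 𝔇.gamL_prodDiffeo η (g t) (u t) L hL]
  have hPd : MDifferentiableAt (𝓘(ℝ, EG).prod 𝓘(ℝ, ES)) 𝓘(ℝ, ED) 𝔇.prodDiffeo (g t, u t) :=
    𝔇.prodDiffeo.contMDiff.mdifferentiableAt (by simp)
  have hQd : MDifferentiableAt 𝓘(ℝ, ED) (𝓘(ℝ, EG).prod 𝓘(ℝ, ES)) 𝔇.prodDiffeo.symm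
      (𝔇.prodDiffeo (g t, u t)) := 𝔇.prodDiffeo.symm.contMDiff.mdifferentiableAt (by simp)
  rw [hΓ]
  constructor
  · intro h
    have h1 := (hasModelDerivAt_modelDeriv hQd).comp h (𝔇.prodDiffeo_apply (g t) (u t)).symm
      (h := fun t => (g t, u t)) (fun s => by
        rw [← 𝔇.prodDiffeo_apply, 𝔇.prodDiffeo.symm_apply_apply])
    have hQP : ∀ w : EG × ES, modelDeriv 𝓘(ℝ, ED) (𝓘(ℝ, EG).prod 𝓘(ℝ, ES)) 𝔇.prodDiffeo.symm
        (𝔇.prodDiffeo (g t, u t)) (P w) = w := by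
      intro w
      rw [hP, modelDeriv_comp hPd hQd rfl (h := fun x => x) (fun z => by simp),
        (hasModelDerivAt_id (I := 𝓘(ℝ, EG).prod 𝓘(ℝ, ES)) (g t, u t)).modelDeriv_eq]
      rfl
    have hfst : HasModelDerivAt (𝓘(ℝ, EG).prod 𝓘(ℝ, ES)) 𝓘(ℝ, EG) (Prod.fst : G × S → G)
      (g t, u t) (ContinuousLinearMap.fst ℝ EG ES) := hasMFDerivAt_fst _
    have hsnd : HasModelDerivAt (𝓘(ℝ, EG).prod 𝓘(ℝ, ES)) 𝓘(ℝ, ES) (Prod.snd : G × S → S)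
      (g t, u t) (ContinuousLinearMap.snd ℝ EG ES) := hasMFDerivAt_snd _
    refine ⟨?_, ?_⟩
    · convert hsnd.comp h1 rfl (fun _ => rfl) using 1
      ext
      simp [hQP]
    · convert hfst.comp h1 rfl (fun _ => rfl) using 1
      ext
      simp [hQP]
  · rintro ⟨hu, hg⟩
    have hgu : HasModelDerivAt 𝓘(ℝ, ℝ) (𝓘(ℝ, EG).prod 𝓘(ℝ, ES)) (fun t => (g t, u t)) t
        (((1 : ℝ →L[ℝ] ℝ).smulRight (trans EG (g t) 1 L)).prod
          ((1 : ℝ →L[ℝ] ℝ).smulRight V)) := HasMFDerivAt.prodMk hg hu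
    convert (hasModelDerivAt_modelDeriv hPd).comp hgu rfl
      (fun s => 𝔇.prodDiffeo_apply (g s) (u s)) using 1
    ext
    simp [hP]

end CompleteDouble

/-! ### Logarithmic derivatives and the exponential map -/

section Exponential

open Filter Topology

variable {E : Type*} [NormedAddCommGroup E] [NormedSpace ℝ E]

/-- On an open set, integral curves have two-sided derivatives. -/
theorem isMIntegralCurveOn_iff_hasModelDerivAt {M : Type*} [TopologicalSpace M]
    [ChartedSpace E M] {γ : ℝ → M}
    {v : ∀ x : M, TangentSpace 𝓘(ℝ, E) x} {s : Set ℝ} (hs : IsOpen s) :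
    IsMIntegralCurveOn (I := 𝓘(ℝ, E)) γ v s ↔
      ∀ t ∈ s, HasModelDerivAt 𝓘(ℝ, ℝ) 𝓘(ℝ, E) γ t
        ((1 : ℝ →L[ℝ] ℝ).smulRight (M₂ := E) (v (γ t))) :=
  ⟨fun h t ht => (h t ht).hasMFDerivAt (hs.mem_nhds ht), fun h t ht =>
    HasMFDerivAt.hasMFDerivWithinAt (h t ht)⟩

variable {G : Type*} [TopologicalSpace G] [ChartedSpace E G] [Group G]

/-- The curve `γ` is differentiable at `t` with left logarithmic derivative `γ⁻¹ γ' = A`. -/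
def HasLogDerivAt (γ : ℝ → G) (t : ℝ) (A : E) : Prop :=
  HasModelDerivAt 𝓘(ℝ, ℝ) 𝓘(ℝ, E) γ t ((1 : ℝ →L[ℝ] ℝ).smulRight (trans E (γ t) 1 A))

theorem isMIntegralCurve_leftTranslate_iff {γ : ℝ → G} {A : E} :
    IsMIntegralCurve (I := 𝓘(ℝ, E)) γ (fun g => leftTranslate g A) ↔
      ∀ t, HasLogDerivAt γ t A := by
  have h : ∀ t, (leftTranslate (γ t) A : E) = trans E (γ t) 1 A := fun t => leftTranslate_apply _ _
  unfold HasLogDerivAt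
  simp only [← h]
  rfl

theorem isMIntegralCurveOn_leftTranslate_iff {γ : ℝ → G} {A : E} {s : Set ℝ} (hs : IsOpen s) :
    IsMIntegralCurveOn (I := 𝓘(ℝ, E)) γ (fun g => leftTranslate g A) s ↔
      ∀ t ∈ s, HasLogDerivAt γ t A := by
  have h : ∀ t, (leftTranslate (γ t) A : E) = trans E (γ t) 1 A := fun t => leftTranslate_apply _ _
  rw [isMIntegralCurveOn_iff_hasModelDerivAt hs]
  unfold HasLogDerivAt
  simp only [← h]

theorem hasLogDerivAt_const (g : G) (t : ℝ) : HasLogDerivAt (fun _ => g) t (0 : E) := by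
  unfold HasLogDerivAt
  convert hasModelDerivAt_const (I := 𝓘(ℝ, ℝ)) (I' := 𝓘(ℝ, E)) g t using 1
  ext
  simp

theorem HasLogDerivAt.comp {γ : ℝ → G} {f : ℝ → ℝ} {t f' : ℝ} {A : E}
    (hγ : HasLogDerivAt γ (f t) A) (hf : HasDerivAt f f' t) :
    HasLogDerivAt (fun s => γ (f s)) t (f' • A) := by
  have h : HasModelDerivAt 𝓘(ℝ, ℝ) 𝓘(ℝ, ℝ) f t ((1 : ℝ →L[ℝ] ℝ).smulRight f') := by
    have h1 := hf.hasFDerivAt.hasMFDerivAt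
    have h2 : ContinuousLinearMap.toSpanSingleton ℝ f' = (1 : ℝ →L[ℝ] ℝ).smulRight f' := by
      ext
      simp
    rwa [h2] at h1
  unfold HasLogDerivAt at hγ ⊢
  convert HasModelDerivAt.comp hγ h rfl (fun _ => rfl) using 1
  ext
  simp

theorem HasLogDerivAt.congr {γ δ : ℝ → G} {t : ℝ} {A : E} (hγ : HasLogDerivAt γ t A)
    (h : δ =ᶠ[𝓝 t] γ) : HasLogDerivAt δ t A := by
  unfold HasLogDerivAt
  rw [h.self_of_nhds]
  exact HasMFDerivAt.congr_of_eventuallyEq hγ h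

variable [LieGroup 𝓘(ℝ, E) ∞ G]

/-- The product rule `(γ δ)⁻¹ (γ δ)' = Ad δ⁻¹ (γ⁻¹ γ') + δ⁻¹ δ'`. -/
theorem HasLogDerivAt.mul {γ δ : ℝ → G} {t : ℝ} {A B : E} (hγ : HasLogDerivAt γ t A)
    (hδ : HasLogDerivAt δ t B) :
    HasLogDerivAt (fun s => γ s * δ s) t (adL E (δ t)⁻¹ A + B) := by
  have h1 : modelDeriv 𝓘(ℝ, E) 𝓘(ℝ, E) (fun y : G => y * δ t) (γ t) (trans E (γ t) 1 A)
      = trans E (γ t * δ t) 1 (adL E (δ t)⁻¹ A) := by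
    rw [trans_adL, trans, modelDeriv_comp (mdifferentiableAt_mul_mul _ _ _)
      (mdifferentiableAt_mul_const _ _) (by simp) (fun _ => rfl), trans]
    simp
  have h2 : modelDeriv 𝓘(ℝ, E) 𝓘(ℝ, E) (fun y : G => γ t * y) (δ t) (trans E (δ t) 1 B)
      = trans E (γ t * δ t) 1 B := by
    rw [trans, modelDeriv_comp (mdifferentiableAt_mul_mul _ _ _)
      (mdifferentiableAt_const_mul _ _) (by simp) (fun _ => rfl), trans]
    simp [mul_assoc]
  unfold HasLogDerivAt
  convert HasModelDerivAt.mul hγ hδ using 1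
  ext
  simp [h1, h2]

theorem HasLogDerivAt.const_mul {γ : ℝ → G} {t : ℝ} {A : E} (hγ : HasLogDerivAt γ t A) (g : G) :
    HasLogDerivAt (fun s => g * γ s) t A := by
  simpa using (hasLogDerivAt_const g t).mul hγ

/-- The derivative of the adjoint action along a curve. -/
theorem HasLogDerivAt.hasDerivAt_adL {γ : ℝ → G} {t : ℝ} {A : E} (hγ : HasLogDerivAt γ t A)
    (B : E) : HasDerivAt (fun s => adL E (γ s) B) (adL E (γ t) (modelBracket G A B)) t := by
  have h1 := hγ.const_mul (γ t)⁻¹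
  unfold HasLogDerivAt at h1
  simp only [inv_mul_cancel, trans_one_one] at h1
  have h2 := (hasModelDerivAt_modelDeriv (mdifferentiableAt_adL_apply B (1 : G))).comp h1
    (inv_mul_cancel _) (fun _ => rfl)
  have h3 := (h2.clm_comp (adL E (γ t))).hasFDerivAt.hasDerivAt
  simp only [← adL_mul, mul_inv_cancel_left] at h3
  simpa [modelDeriv_adL_apply_one] using h3

theorem contMDiff_leftTranslate (A : E) :
    ContMDiff 𝓘(ℝ, E) 𝓘(ℝ, E).tangent 1
      (fun g : G => (⟨g, leftTranslate g A⟩ : TangentBundle 𝓘(ℝ, E) G)) := by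
  have h3 : LieGroup 𝓘(ℝ, E) (minSmoothness ℝ 3) G :=
    LieGroup.of_le (n := ∞) (by
      rw [minSmoothness_of_isRCLikeNormedField]; exact ENat.LEInfty.out)
  exact (contMDiff_mulInvariantVectorField (A : GroupLieAlgebra 𝓘(ℝ, E) G)).of_le (by
    rw [minSmoothness_of_isRCLikeNormedField]; exact one_le_two)

variable [T2Space G]

/-- A curve with vanishing derivative on an open interval is constant. -/
theorem eq_of_hasLogDerivAt_zero {γ : ℝ → G} {J : Set ℝ} (hJ : IsOpen J) (hJ' : J.OrdConnected)
    (h : ∀ t ∈ J, HasLogDerivAt γ t (0 : E)) {s t : ℝ} (hs : s ∈ J) (ht : t ∈ J) : γ t = γ s := by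
  have : IsManifold 𝓘(ℝ, E) 1 G := IsManifold.of_le (n := ∞) (by simp)
  have hmin : min s t ∈ J := by rcases min_choice s t with h | h <;> rwa [h]
  have hmax : max s t ∈ J := by rcases max_choice s t with h | h <;> rwa [h]
  obtain ⟨a, ha, haJ⟩ := ((eventually_mem_nhdsWithin (a := min s t) (s := Iio (min s t))).and
    (nhdsWithin_le_nhds (hJ.mem_nhds hmin))).exists
  obtain ⟨b, hb, hbJ⟩ := ((eventually_mem_nhdsWithin (a := max s t) (s := Ioi (max s t))).and
    (nhdsWithin_le_nhds (hJ.mem_nhds hmax))).exists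
  have hsub : Ioo a b ⊆ J := Ioo_subset_Icc_self.trans (hJ'.out haJ hbJ)
  have hs' : s ∈ Ioo a b := ⟨ha.trans_le (min_le_left _ _), (le_max_left _ _).trans_lt hb⟩
  have ht' : t ∈ Ioo a b := ⟨ha.trans_le (min_le_right _ _), (le_max_right _ _).trans_lt hb⟩
  exact isMIntegralCurveOn_Ioo_eqOn_of_contMDiff_boundaryless hs' (contMDiff_leftTranslate (0 : E))
    ((isMIntegralCurveOn_leftTranslate_iff isOpen_Ioo).2 fun r hr => h r (hsub hr))
    ((isMIntegralCurveOn_leftTranslate_iff isOpen_Ioo).2 fun r _ => hasLogDerivAt_const (γ s) r)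
    rfl ht'

variable [FiniteDimensional ℝ E]

/-- Left-invariant vector fields are complete, since all their integral curves are left translates
of one local integral curve and so are defined for a uniform time. -/
theorem exists_oneParameter (A : E) : ∃ γ : ℝ → G, (∀ t, HasLogDerivAt γ t A) ∧ γ 0 = 1 := by
  have : IsManifold 𝓘(ℝ, E) 1 G := IsManifold.of_le (n := ∞) (by simp)
  have : CompleteSpace E := FiniteDimensional.complete ℝ E
  obtain ⟨γ, h0, hγ⟩ := exists_isMIntegralCurveAt_of_contMDiffAt_boundaryless 0
    (contMDiff_leftTranslate A).contMDiffAt (x₀ := (1 : G))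
  obtain ⟨ε, hε, hγ⟩ := isMIntegralCurveAt_iff'.1 hγ
  rw [Real.ball_eq_Ioo, zero_sub, zero_add] at hγ
  have hloc : ∀ x : G, ∃ δ, δ 0 = x ∧
      IsMIntegralCurveOn (I := 𝓘(ℝ, E)) δ (fun g => leftTranslate g A) (Ioo (-ε) ε) :=
    fun x => ⟨fun t => x * γ t, by simp [h0],
      (isMIntegralCurveOn_leftTranslate_iff isOpen_Ioo).2 fun t ht =>
        ((isMIntegralCurveOn_leftTranslate_iff isOpen_Ioo).1 hγ t ht).const_mul x⟩
  obtain ⟨δ, h0, hδ⟩ := exists_isMIntegralCurve_of_isMIntegralCurveOn (contMDiff_leftTranslate A)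
    hε hloc 1
  exact ⟨δ, isMIntegralCurve_leftTranslate_iff.1 hδ, h0⟩

variable (G) in
/-- The one-parameter subgroup with velocity `A` at the unit. -/
def oneParameter (A : E) : ℝ → G := (exists_oneParameter (G := G) A).choose

theorem hasLogDerivAt_oneParameter (A : E) (t : ℝ) : HasLogDerivAt (oneParameter G A) t A :=
  (exists_oneParameter (G := G) A).choose_spec.1 t

theorem oneParameter_zero (A : E) : oneParameter G A 0 = 1 :=
  (exists_oneParameter (G := G) A).choose_spec.2

/-- Integral curves of left-invariant vector fields are unique. -/
theorem eq_oneParameter {A : E} {γ : ℝ → G} (hγ : ∀ t, HasLogDerivAt γ t A) (h0 : γ 0 = 1) :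
    γ = oneParameter G A := by
  have : IsManifold 𝓘(ℝ, E) 1 G := IsManifold.of_le (n := ∞) (by simp)
  exact isMIntegralCurve_Ioo_eq_of_contMDiff_boundaryless (contMDiff_leftTranslate A)
    (isMIntegralCurve_leftTranslate_iff.2 hγ)
    (isMIntegralCurve_leftTranslate_iff.2 (hasLogDerivAt_oneParameter A)) (t₀ := 0)
    (h0.trans (oneParameter_zero A).symm)

variable (G) in
/-- The exponential map, on the model space. -/
def expL (A : E) : G := lieExp (E := E) (G := G) A

theorem oneParameter_one (A : E) : oneParameter G A 1 = expL G A := by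
  have h : ∃ γ : ℝ → G, IsMIntegralCurve (I := 𝓘(ℝ, E)) γ (fun g => leftTranslate g A) ∧ γ 0 = 1 :=
    ⟨oneParameter G A, isMIntegralCurve_leftTranslate_iff.2 (hasLogDerivAt_oneParameter A),
      oneParameter_zero A⟩
  have h1 : expL G A = h.choose 1 := dif_pos h
  rw [h1, eq_oneParameter (isMIntegralCurve_leftTranslate_iff.1 h.choose_spec.1) h.choose_spec.2]

theorem oneParameter_eq (A : E) (t : ℝ) : oneParameter G A t = expL G (t • A) := by
  have h : (fun s => oneParameter G A (s * t)) = oneParameter G (t • A) := by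
    refine eq_oneParameter (fun s => ?_) (by simp [oneParameter_zero])
    exact (hasLogDerivAt_oneParameter A (s * t)).comp (f := fun s => s * t)
      (by simpa using (hasDerivAt_id s).mul_const t)
  rw [← oneParameter_one, ← h]
  simp only [one_mul]

theorem expL_zero : expL G (0 : E) = 1 := by
  rw [← zero_smul ℝ (0 : E), ← oneParameter_eq, oneParameter_zero]

theorem hasLogDerivAt_expL (A : E) {f : ℝ → ℝ} {f' t : ℝ} (hf : HasDerivAt f f' t) :
    HasLogDerivAt (fun s => expL G (f s • A)) t (f' • A) := by
  simp only [← oneParameter_eq]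
  exact (hasLogDerivAt_oneParameter A (f t)).comp hf

/-- If `A` and `B` commute, then `exp A` acts trivially on `B`. -/
theorem adL_expL {A B : E} (h : modelBracket G A B = 0) : adL E (expL G A) B = B := by
  have hd : ∀ t, HasDerivAt (fun s => adL E (oneParameter G A s) B) 0 t := fun t => by
    simpa [h] using (hasLogDerivAt_oneParameter (G := G) A t).hasDerivAt_adL B
  have := is_const_of_deriv_eq_zero (fun t => (hd t).differentiableAt) (fun t => (hd t).deriv) 1 0
  simpa [oneParameter_zero, oneParameter_one, adL_one] using this

theorem adL_inv_expL {A B : E} (h : modelBracket G A B = 0) : adL E (expL G A)⁻¹ B = B := by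
  conv_lhs => rw [← adL_expL (G := G) h, adL_inv_adL]

/-- The exponential map is multiplicative on commuting elements. -/
theorem expL_add {A B : E} (h : ∀ t : ℝ, modelBracket G (t • B) A = 0) :
    expL G (A + B) = expL G A * expL G B := by
  have h1 : (fun t => oneParameter G A t * oneParameter G B t) = oneParameter G (A + B) := by
    refine eq_oneParameter (fun t => ?_) (by simp [oneParameter_zero])
    have := (hasLogDerivAt_oneParameter (G := G) A t).mul (hasLogDerivAt_oneParameter B t)
    rwa [oneParameter_eq B t, adL_inv_expL (G := G) (h t)] at this
  rw [← oneParameter_one, ← h1]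
  simp only [oneParameter_one]

/-- The logarithmic derivative of the exponential of a curve in a commutative subalgebra, given by
its coordinates. -/
theorem hasLogDerivAt_expL_sum {𝔞 : Submodule ℝ E}
    (h𝔞 : ∀ A ∈ 𝔞, ∀ B ∈ 𝔞, modelBracket G A B = 0) {κ : Type*} {b : κ → E} (hb : ∀ j, b j ∈ 𝔞)
    {z : κ → ℝ → ℝ} {z' : κ → ℝ} {t : ℝ} (hz : ∀ j, HasDerivAt (z j) (z' j) t) (F : Finset κ) :
    HasLogDerivAt (fun s => expL G (∑ j ∈ F, z j s • b j)) t (∑ j ∈ F, z' j • b j) := by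
  classical
  induction F using Finset.induction_on with
  | empty =>
    simp only [Finset.sum_empty, expL_zero]
    exact hasLogDerivAt_const 1 t
  | insert j F hj ih =>
    have hmem : ∀ y : κ → ℝ, ∑ j ∈ F, y j • b j ∈ 𝔞 := fun y =>
      𝔞.sum_mem fun j _ => 𝔞.smul_mem _ (hb j)
    simp only [Finset.sum_insert hj]
    have hadd : ∀ s, expL G (z j s • b j + ∑ j ∈ F, z j s • b j)
        = expL G (z j s • b j) * expL G (∑ j ∈ F, z j s • b j) := fun s =>
      expL_add fun r => h𝔞 _ (𝔞.smul_mem r (hmem _)) _ (𝔞.smul_mem _ (hb j))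
    simp only [hadd]
    have := (hasLogDerivAt_expL (G := G) (b j) (hz j)).mul ih
    rwa [adL_inv_expL (h𝔞 _ (hmem _) _ (𝔞.smul_mem _ (hb j)))] at this

/-- The logarithmic derivative of the exponential of a curve in a commutative subalgebra. -/
theorem hasLogDerivAt_expL_of_mem {𝔞 : Submodule ℝ E}
    (h𝔞 : ∀ A ∈ 𝔞, ∀ B ∈ 𝔞, modelBracket G A B = 0) {Z : ℝ → E} {Z' : E} {J : Set ℝ}
    (hJ : IsOpen J) {t : ℝ} (ht : t ∈ J) (hmem : ∀ s ∈ J, Z s ∈ 𝔞) (hmem' : Z' ∈ 𝔞)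
    (hZ : HasDerivAt Z Z' t) : HasLogDerivAt (fun s => expL G (Z s)) t Z' := by
  obtain ⟨p, hp⟩ := LinearMap.exists_leftInverse_of_injective 𝔞.subtype 𝔞.ker_subtype
  set b := Module.finBasis ℝ 𝔞
  have hsum : ∀ A ∈ 𝔞, ∑ j, b.repr (p A) j • (b j : E) = A := by
    intro A hA
    have h1 : p A = ⟨A, hA⟩ := LinearMap.congr_fun hp ⟨A, hA⟩
    have h2 := congrArg 𝔞.subtype (b.sum_repr (p A))
    rw [map_sum] at h2
    simpa [h1] using h2
  have hz : ∀ j, HasDerivAt (fun s => b.repr (p (Z s)) j) (b.repr (p Z') j) t := fun j =>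
    ((b.coord j ∘ₗ p).toContinuousLinearMap.hasFDerivAt.comp_hasDerivAt t hZ)
  have h := hasLogDerivAt_expL_sum (G := G) h𝔞 (fun j => (b j).2) hz Finset.univ
  rw [hsum Z' hmem'] at h
  refine h.congr ?_
  filter_upwards [hJ.mem_nhds ht] with s hs
  rw [hsum _ (hmem s hs)]

/-- The equation `g⁻¹ g' = Z'` with commuting velocities is solved by the exponential map. -/
theorem hasLogDerivAt_iff_eq_mul_expL {𝔞 : Submodule ℝ E}
    (h𝔞 : ∀ A ∈ 𝔞, ∀ B ∈ 𝔞, modelBracket G A B = 0) {Z L : ℝ → E} {J : Set ℝ}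
    (hJ : IsOpen J) (hJ' : J.OrdConnected) {t₀ : ℝ} (ht₀ : t₀ ∈ J) (hZ₀ : Z t₀ = 0)
    (hZ : ∀ t ∈ J, HasDerivAt Z (L t) t) (hL : ∀ t ∈ J, L t ∈ 𝔞) (hmem : ∀ t ∈ J, Z t ∈ 𝔞)
    (g : ℝ → G) :
    (∀ t ∈ J, HasLogDerivAt g t (L t)) ↔ ∀ t ∈ J, g t = g t₀ * expL G (Z t) := by
  have hneg : ∀ t ∈ J, HasLogDerivAt (fun s => expL G (-Z s)) t (-L t) := fun t ht =>
    hasLogDerivAt_expL_of_mem h𝔞 hJ ht (fun s hs => 𝔞.neg_mem (hmem s hs))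
      (𝔞.neg_mem (hL t ht)) (hZ t ht).neg
  constructor
  · intro h t ht
    have hconst := eq_of_hasLogDerivAt_zero (E := E) (γ := fun s => g s * expL G (-Z s)) hJ hJ'
      (fun s hs => by
        have := (h s hs).mul (hneg s hs)
        rwa [adL_inv_expL (h𝔞 _ (𝔞.neg_mem (hmem s hs)) _ (hL s hs)), add_neg_cancel] at this)
      ht₀ ht
    simp only [hZ₀, neg_zero, expL_zero, mul_one] at hconst
    rw [← hconst, mul_assoc, ← expL_add, neg_add_cancel, expL_zero, mul_one]
    exact fun r => h𝔞 _ (𝔞.smul_mem r (hmem t ht)) _ (𝔞.neg_mem (hmem t ht))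
  · intro h t ht
    refine ((hasLogDerivAt_expL_of_mem h𝔞 hJ ht hmem (hL t ht) (hZ t ht)).const_mul (g t₀)).congr ?_
    filter_upwards [hJ.mem_nhds ht] with s hs using h s hs

end Exponential

/-! ### Continuity of the velocities -/

section RightInvariant

variable {E : Type*} [NormedAddCommGroup E] [NormedSpace ℝ E]
  {G : Type*} [TopologicalSpace G] [ChartedSpace E G] [Group G] [LieGroup 𝓘(ℝ, E) ∞ G]

/-- Right-invariant vector fields are smooth: the field `g ↦ Y g` is the composition of the
tangent map of the multiplication with the smooth map `g ↦ (Y, 0) ∈ T_1 G × T_g G`. -/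
theorem contMDiff_rightTranslate (Y : E) :
    ContMDiff 𝓘(ℝ, E) 𝓘(ℝ, E).tangent ∞
      (fun g : G => (⟨g, rightTranslate g Y⟩ : TangentBundle 𝓘(ℝ, E) G)) := by
  have hz : ContMDiff 𝓘(ℝ, E) 𝓘(ℝ, E).tangent ∞
      (fun g : G => (Bundle.TotalSpace.mk' E g 0 : TangentBundle 𝓘(ℝ, E) G)) :=
    Bundle.contMDiff_zeroSection _ _
  have hY : ContMDiff 𝓘(ℝ, E) 𝓘(ℝ, E).tangent ∞
      (fun _ : G => (Bundle.TotalSpace.mk' E 1 Y : TangentBundle 𝓘(ℝ, E) G)) := contMDiff_const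
  have hm : ContMDiff (𝓘(ℝ, E).prod 𝓘(ℝ, E)).tangent 𝓘(ℝ, E).tangent ∞
      (tangentMap (𝓘(ℝ, E).prod 𝓘(ℝ, E)) 𝓘(ℝ, E) (fun p : G × G => p.1 * p.2)) :=
    ContMDiff.contMDiff_tangentMap (contMDiff_mul 𝓘(ℝ, E) ∞) (by simp)
  have he : ContMDiff (𝓘(ℝ, E).tangent.prod 𝓘(ℝ, E).tangent) (𝓘(ℝ, E).prod 𝓘(ℝ, E)).tangent ∞
      (equivTangentBundleProd 𝓘(ℝ, E) G 𝓘(ℝ, E) G).symm :=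
    contMDiff_equivTangentBundleProd_symm
  have h := (hm.comp he).comp (hY.prodMk hz)
  convert! h with g
  · simp
  · simp only [Function.comp_apply, tangentMap]
    rw [mfderiv_prod_eq_add_apply ((contMDiff_mul 𝓘(ℝ, E) ∞).mdifferentiableAt (by simp))]
    have h1 : (rightTranslate g Y : E) = modelDeriv 𝓘(ℝ, E) 𝓘(ℝ, E) (fun x : G => x * g) 1 Y
        + modelDeriv 𝓘(ℝ, E) 𝓘(ℝ, E) (fun x : G => 1 * x) g 0 := by
      rw [map_zero, add_zero]
      rfl
    exact h1

/-- The function `⟨Y^r, η⟩` is continuous for a smooth 1-form `η`. -/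
theorem continuous_pairRight {η : ∀ u : G, TangentSpace 𝓘(ℝ, E) u →L[ℝ] ℝ}
    (hη : ContMDiff 𝓘(ℝ, E) (𝓘(ℝ, E).prod 𝓘(ℝ, E →L[ℝ] ℝ)) ∞
      (fun u : G => Bundle.TotalSpace.mk' (E →L[ℝ] ℝ)
        (E := fun u : G => TangentSpace 𝓘(ℝ, E) u →L[ℝ] Bundle.Trivial G ℝ u) u (η u)))
    (Y : GroupLieAlgebra 𝓘(ℝ, E) G) : Continuous (pairRight η Y) := by
  have : IsManifold 𝓘(ℝ, E) 1 G := IsManifold.of_le (n := ∞) (by simp)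
  have h := ContMDiff.clm_bundle_apply (F₁ := E) (F₂ := ℝ) (E₂ := Bundle.Trivial G ℝ)
    hη (contMDiff_rightTranslate (E := E) Y)
  have h2 : Continuous fun u : G => (Bundle.TotalSpace.mk' ℝ u (pairRight η Y u) :
    Bundle.TotalSpace ℝ (Bundle.Trivial G ℝ)) := h.continuous
  exact (Bundle.Trivial.homeomorphProd G ℝ).continuous.comp h2 |>.snd

end RightInvariant

/-! ### Solution by quadratures -/

section Quadrature

variable {E : Type*} [NormedAddCommGroup E] [NormedSpace ℝ E] [FiniteDimensional ℝ E]
  {G : Type*} [TopologicalSpace G] [ChartedSpace E G] [Group G] [LieGroup 𝓘(ℝ, E) ∞ G] [T2Space G]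

theorem hasDerivAt_integral_of_continuousOn {f : ℝ → ℝ} {J : Set ℝ} (hJ : IsOpen J)
    (hJ' : J.OrdConnected) (hf : ContinuousOn f J) {t₀ t : ℝ} (ht₀ : t₀ ∈ J) (ht : t ∈ J) :
    HasDerivAt (fun t => ∫ s in t₀..t, f s) (f t) t :=
  intervalIntegral.integral_hasDerivAt_right
    (hf.mono (hJ'.uIcc_subset ht₀ ht)).intervalIntegrable
    (hf.stronglyMeasurableAtFilter hJ t ht) (hf.continuousAt (hJ.mem_nhds ht))

/-- The integral of a curve in a subspace, given by its coordinates, lies in the subspace. -/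
theorem sum_integral_smul_mem {ι : Type*} [Fintype ι] {X : ι → E} {𝔞 : Submodule ℝ E}
    {f : ι → ℝ → ℝ} {J : Set ℝ} (hJ' : J.OrdConnected) (hf : ∀ i, ContinuousOn (f i) J)
    (h : ∀ t ∈ J, ∑ i, f i t • X i ∈ 𝔞) {t₀ t : ℝ} (ht₀ : t₀ ∈ J) (ht : t ∈ J) :
    ∑ i, (∫ s in t₀..t, f i s) • X i ∈ 𝔞 := by
  have hsub := hJ'.uIcc_subset ht₀ ht
  -- a functional that vanishes on the subspace vanishes on the integral
  by_contra hn
  obtain ⟨φ, hφ, hφ'⟩ := 𝔞.exists_dual_map_eq_bot_of_notMem hn inferInstance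
  have hz : ∀ A ∈ 𝔞, φ A = 0 := fun A hA => by
    have : φ A ∈ 𝔞.map φ := Submodule.mem_map_of_mem hA
    rwa [hφ', Submodule.mem_bot] at this
  refine hφ ?_
  have h1 : ∫ s in t₀..t, ∑ i, f i s * φ (X i) = ∑ i, (∫ s in t₀..t, f i s) * φ (X i) := by
    have hint : ∀ i ∈ Finset.univ, IntervalIntegrable (fun s => f i s * φ (X i))
        MeasureTheory.volume t₀ t := fun i _ =>
      (((hf i).mono hsub).mul continuousOn_const).intervalIntegrable
    rw [intervalIntegral.integral_finsetSum hint]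
    simp only [intervalIntegral.integral_mul_const]
  have h2 : ∫ s in t₀..t, ∑ i, f i s * φ (X i) = ∫ _ in t₀..t, (0 : ℝ) :=
    intervalIntegral.integral_congr fun s hs => by
      simpa using hz _ (h s (hsub hs))
  simpa [← h1] using h2

/-- The equation `g⁻¹ g' = ∑ i, f i X i`, with velocities in a commutative subalgebra, is solved by
quadratures. -/
theorem hasLogDerivAt_iff_eq_mul_expL_integral {ι : Type*} [Fintype ι] {X : ι → E}
    {𝔞 : Submodule ℝ E} (h𝔞 : ∀ A ∈ 𝔞, ∀ B ∈ 𝔞, modelBracket G A B = 0) {f : ι → ℝ → ℝ}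
    {J : Set ℝ} (hJ : IsOpen J) (hJ' : J.OrdConnected) {t₀ : ℝ} (ht₀ : t₀ ∈ J)
    (hf : ∀ i, ContinuousOn (f i) J) (h : ∀ t ∈ J, ∑ i, f i t • X i ∈ 𝔞) (g : ℝ → G) :
    (∀ t ∈ J, HasLogDerivAt g t (∑ i, f i t • X i)) ↔
      ∀ t ∈ J, g t = g t₀ * expL G (∑ i, (∫ s in t₀..t, f i s) • X i) :=
  hasLogDerivAt_iff_eq_mul_expL h𝔞 hJ hJ' ht₀ (by simp)
    (fun t ht => HasDerivAt.fun_sum fun i _ =>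
      (hasDerivAt_integral_of_continuousOn hJ hJ' (hf i) ht₀ ht).smul_const (X i))
    h (fun _ ht => sum_integral_smul_mem hJ' hf h ht₀ ht) g

end Quadrature

/-! ### The element of `𝔤` given by a 1-form -/

namespace CompleteDouble

variable {EG : Type*} [NormedAddCommGroup EG] [NormedSpace ℝ EG]
  {G : Type*} [TopologicalSpace G] [ChartedSpace EG G] [Group G]
  {ES : Type*} [NormedAddCommGroup ES] [NormedSpace ℝ ES]
  {S : Type*} [TopologicalSpace S] [ChartedSpace ES S] [Group S]
  {ED : Type*} [NormedAddCommGroup ED] [NormedSpace ℝ ED]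
  {D : Type*} [TopologicalSpace D] [ChartedSpace ED D] [Group D]
  {ΛG : BivectorField EG G} {ΛS : BivectorField ES S} (𝔇 : CompleteDouble ED D ΛG ΛS)

/-- The element `∑ i, ⟨Y_i^r, η⟩ X i` of `𝔤` represents `η` in the right trivialization. -/
theorem pairL_sum_pairRight {ι : Type*} [Fintype ι] [DecidableEq ι]
    (X : Module.Basis ι ℝ (GroupLieAlgebra 𝓘(ℝ, EG) G))
    (Y : Module.Basis ι ℝ (GroupLieAlgebra 𝓘(ℝ, ES) S))
    (hXY : ∀ i j, 𝔇.pairing (X i) (Y j) = if i = j then 1 else 0)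
    (η : ∀ u : S, TangentSpace 𝓘(ℝ, ES) u →L[ℝ] ℝ) (u : S) (Z : ES) :
    𝔇.pairL (∑ i, pairRight η (Y i) u • X i) Z = modelForm η u (trans ES 1 u Z) := by
  have h : 𝔇.pairing (∑ i, pairRight η (Y i) u • X i)
      = (modelForm η u).toLinearMap ∘ₗ rightTranslate u := by
    refine Y.ext fun j => ?_
    simp only [map_sum, map_smul, LinearMap.sum_apply, LinearMap.smul_apply, hXY, smul_eq_mul,
      mul_ite, mul_one, mul_zero, Finset.sum_ite_eq', Finset.mem_univ, if_true]
    rfl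
  exact (LinearMap.congr_fun h Z).trans (congrArg (modelForm η u) (rightTranslate_apply u Z))

end CompleteDouble

end PoissonLie

end

theorem theorem2
    {EG : Type*} [NormedAddCommGroup EG] [NormedSpace ℝ EG] [FiniteDimensional ℝ EG]
    {G : Type*} [TopologicalSpace G] [T2Space G] [ChartedSpace EG G] [Group G]
    [LieGroup 𝓘(ℝ, EG) ∞ G]
    {ES : Type*} [NormedAddCommGroup ES] [NormedSpace ℝ ES] [FiniteDimensional ℝ ES]
    {S : Type*} [TopologicalSpace S] [T2Space S] [ChartedSpace ES S] [Group S]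
    [LieGroup 𝓘(ℝ, ES) ∞ S]
    {ED : Type*} [NormedAddCommGroup ED] [NormedSpace ℝ ED] [FiniteDimensional ℝ ED]
    {D : Type*} [TopologicalSpace D] [T2Space D] [ChartedSpace ED D] [Group D]
    [LieGroup 𝓘(ℝ, ED) ∞ D]
    {ΛG : PoissonLie.BivectorField EG G} {ΛS : PoissonLie.BivectorField ES S}
    (𝔇 : PoissonLie.CompleteDouble ED D ΛG ΛS)
    {ι : Type*} [Fintype ι] [DecidableEq ι]
    (X : Module.Basis ι ℝ (GroupLieAlgebra 𝓘(ℝ, EG) G))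
    (Y : Module.Basis ι ℝ (GroupLieAlgebra 𝓘(ℝ, ES) S))
    (hXY : ∀ i j, 𝔇.pairing (X i) (Y j) = if i = j then 1 else 0)
    (η : ∀ u : S, TangentSpace 𝓘(ℝ, ES) u →L[ℝ] ℝ)
    (hη : ContMDiff 𝓘(ℝ, ES) (𝓘(ℝ, ES).prod 𝓘(ℝ, ES →L[ℝ] ℝ)) ∞
      (fun u : S => Bundle.TotalSpace.mk' (ES →L[ℝ] ℝ)
        (E := fun u : S => TangentSpace 𝓘(ℝ, ES) u →L[ℝ] Bundle.Trivial S ℝ u) u (η u))) :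
    -- the vector field in the coordinates `(g, u)`
    (∀ (g : G) (u : S),
      𝔇.Gam η (𝔇.prodDiffeo (g, u)) =
        mfderiv (𝓘(ℝ, EG).prod 𝓘(ℝ, ES)) 𝓘(ℝ, ED) 𝔇.prodDiffeo (g, u)
          ((PoissonLie.leftTranslate g (∑ i, PoissonLie.pairRight η (Y i) u • X i),
            PoissonLie.momentumField ΛS η u) :
              TangentSpace 𝓘(ℝ, EG) g × TangentSpace 𝓘(ℝ, ES) u)) ∧
    -- the equations of motion
    (∀ (J : Set ℝ), IsOpen J → ∀ (g : ℝ → G) (u : ℝ → S),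
      IsMIntegralCurveOn (I := 𝓘(ℝ, ED)) (fun t => 𝔇.incl (g t) * 𝔇.inclDual (u t))
          (𝔇.Gam η) J ↔
        IsMIntegralCurveOn (I := 𝓘(ℝ, ES)) u (PoissonLie.momentumField ΛS η) J ∧
        ∀ t ∈ J, HasMFDerivAt 𝓘(ℝ, ℝ) 𝓘(ℝ, EG) g t
          ((1 : ℝ →L[ℝ] ℝ).smulRight
            (PoissonLie.leftTranslate (g t)
              (∑ i, PoissonLie.pairRight η (Y i) (u t) • X i)))) ∧
    -- integration by quadratures over a given solution `u` of the momentum equation whose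
    -- velocities lie in a commutative subalgebra `𝔞` (a subspace with vanishing brackets)
    (∀ (J : Set ℝ), IsOpen J → J.OrdConnected → ∀ t₀ ∈ J, ∀ u : ℝ → S,
      IsMIntegralCurveOn (I := 𝓘(ℝ, ES)) u (PoissonLie.momentumField ΛS η) J →
      ∀ 𝔞 : Submodule ℝ (GroupLieAlgebra 𝓘(ℝ, EG) G),
      (∀ A ∈ 𝔞, ∀ B ∈ 𝔞, ⁅A, B⁆ = 0) →
      (∀ t ∈ J, ∑ i, PoissonLie.pairRight η (Y i) (u t) • X i ∈ 𝔞) →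
      (∀ i, ContinuousOn (fun s => PoissonLie.pairRight η (Y i) (u s)) J) ∧
      ∀ g : ℝ → G,
        IsMIntegralCurveOn (I := 𝓘(ℝ, ED)) (fun t => 𝔇.incl (g t) * 𝔇.inclDual (u t))
            (𝔇.Gam η) J ↔
          ∀ t ∈ J, g t = g t₀ * PoissonLie.lieExp
            (∑ i, (∫ s in t₀..t, PoissonLie.pairRight η (Y i) (u s)) • X i)) := by
  have hL : ∀ u, ∀ Z : ES, 𝔇.pairL (∑ i, PoissonLie.pairRight η (Y i) u • X i) Z
      = PoissonLie.modelForm η u (PoissonLie.trans ES 1 u Z) :=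
    fun u => 𝔇.pairL_sum_pairRight X Y hXY η u
  have h2 : ∀ (J : Set ℝ), IsOpen J → ∀ (g : ℝ → G) (u : ℝ → S),
      IsMIntegralCurveOn (I := 𝓘(ℝ, ED)) (fun t => 𝔇.incl (g t) * 𝔇.inclDual (u t))
          (𝔇.Gam η) J ↔
        IsMIntegralCurveOn (I := 𝓘(ℝ, ES)) u (PoissonLie.momentumField ΛS η) J ∧
        ∀ t ∈ J, PoissonLie.HasLogDerivAt (E := EG) g t
          (∑ i, PoissonLie.pairRight η (Y i) (u t) • X i) := by
    intro J hJ g u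
    rw [PoissonLie.isMIntegralCurveOn_iff_hasModelDerivAt hJ,
      PoissonLie.isMIntegralCurveOn_iff_hasModelDerivAt hJ, ← forall₂_and]
    exact forall₂_congr fun t _ => 𝔇.hasModelDerivAt_mul_iff η g u t _ (hL (u t))
  refine ⟨fun g u => ?_, fun J hJ g u => ?_, fun J hJ hJ' t₀ ht₀ u hu 𝔞 h𝔞 hmem => ?_⟩
  · rw [PoissonLie.leftTranslate_apply]
    exact 𝔇.gamL_prodDiffeo η g u _ (hL u)
  · simp only [PoissonLie.leftTranslate_apply]
    exact h2 J hJ g u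
  · have hcont : ∀ i, ContinuousOn (fun s => PoissonLie.pairRight η (Y i) (u s)) J := fun i =>
      (PoissonLie.continuous_pairRight hη (Y i)).comp_continuousOn
        fun t ht => (hu t ht).continuousWithinAt
    refine ⟨hcont, fun g => ?_⟩
    rw [h2 J hJ g u, and_iff_right hu]
    exact PoissonLie.hasLogDerivAt_iff_eq_mul_expL_integral (E := EG) (X := X) h𝔞 hJ
      hJ' ht₀ hcont hmem g
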